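/- Graphs are finite multigraphs. For a graph $G$ let $\Psi_G=\sum_T\prod_{e\notin T}x_e\in\mathbb{Q}[x_e : e\in E(G)]$, the sum over all spanning trees $T$ of $G$, be its Kirchhoff polynomial ($0$ if $G$ is disconnected). A source-terminal graph is a graph $G$ with two distinct marked vertices, the source $s$ and the terminal $t$; let $\Phi_G$ be the Kirchhoff polynomial of the graph obtained from $G$ by identifying $s$ and $t$. The parallel join $G\star H$ of source-terminal graphs is their disjoint union with the two sources identified and the two terminals identified; the series join $G\cdot H$ is their disjoint union with the terminal of $G$ identified with the source of $H$, with the source of $G$ as source and the terminal of $H$ as terminal. A decomposition tree is a rooted binary tree with ordered children whose leaves represent single edges (joining source to terminal) and whose interior vertices are each labelled by one of the operations $\cdot,\star$; it determines a series-parallel graph, and it is a decomposition tree of every source-terminal graph isomorphic to that graph (by an isomorphism preserving source and terminal). The dual $\Upsilon^\vee$ of a decomposition tree $\Upsilon$ is obtained by exchanging $\cdot$ and $\star$ at every interior vertex. For an edge $e$ of a source-terminal graph $G$, $S(G,e)$ says that there are polynomials $A_j$ ($j\in E(G)$), $B$, $C$ in $\mathbb{Q}[x_j : j\in E(G)]$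 with $$\Psi_G=\sum_j A_j\,\partial_j\partial_e\Psi_G+B\,\partial_e\Psi_G,\qquad \Phi_G=\sum_j A_j\,\partial_j\partial_e\Phi_G+C\,\partial_e\Phi_G .$$ Condition 1 for the edge $e$ of $G$ says that $\Psi_G$ lies in the ideal generated by all partial derivatives of $\Psi_{G\smallsetminus e}$. Let $n\ge 2$ and let $H_1^\vee,\dots,H_n^\vee$ be source-terminal graphs such that each $H_i^\vee$ is either a path (with at least one edge) from its source to its terminal, or has a planar embedding with a face whose boundary is a Hamiltonian cycle of $H_i^\vee$ (of length at least $2$, two parallel edges forming a cycle of length $2$) on which the source and the terminal are consecutive. Let $G^\vee=H_1^\vee\cdot H_2^\vee\cdots H_n^\vee$ be their series join, let $\Upsilon^\vee$ be any decomposition tree of $G^\vee$, and let $G$ be the series-parallel graph determined by the dual of $\Upsilon^\vee$. If $G^\vee$ has at least $4$ vertices, then $S(G,e)$ and condition 1 for $e$ in $G$ hold for every edge $e$ of $G$. -/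

import Mathlib

universe u

noncomputable section

open scoped Graph

/-! ### Multigraphs, trees and the Kirchhoff polynomial -/

namespace SeriesParallel

section Multigraph

variable {α β : Type*}

/-- `G` is connected: it has a vertex, and any two vertices are joined by a walk. -/
def IsConnected (G : Graph α β) : Prop :=
  V(G).Nonempty ∧ ∀ x ∈ V(G), ∀ y ∈ V(G), Relation.ReflTransGen G.Adj x y

/-- `G` has no cycles (loops and pairs of parallel edges count as cycles): every edge is a bridge,
that is, deleting an edge separates its two ends. -/
def IsAcyclic (G : Graph α β) : Prop :=
  ∀ e x y, G.IsLink e x y → ¬ Relation.ReflTransGen (G.deleteEdges {e}).Adj x y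

/-- The edge set `T` is (the edge set of) a spanning tree of `G`. -/
def IsSpanningTree (G : Graph α β) (T : Set β) : Prop :=
  T ⊆ E(G) ∧ IsConnected (G.restrict T) ∧ IsAcyclic (G.restrict T)

open Classical in
/-- The Kirchhoff polynomial of `G`: the sum over all spanning trees `T` of the product of the
variables of the edges of `G` outside `T`. It is `0` for a disconnected graph. -/
def kirchhoff [Fintype β] (G : Graph α β) : MvPolynomial β ℚ :=
  ∑ T ∈ (Finset.univ : Finset (Finset β)).filter (fun T : Finset β => IsSpanningTree G (T : Set β)),
    ∏ e ∈ (Finset.univ : Finset β).filter (fun e : β => e ∈ E(G) ∧ e ∉ T), MvPolynomial.X e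

open Classical in
/-- The graph obtained from `G` by identifying the vertex `t` with the vertex `s`. -/
def identify (G : Graph α β) (s t : α) : Graph α β :=
  G.map fun x => if x = t then s else x

/-- Aluffi's condition 1 for the edge `e` of `G`: the Kirchhoff polynomial of `G` lies in the
Jacobian ideal of the Kirchhoff polynomial of `G` with `e` deleted. -/
def ConditionOne [Fintype β] (G : Graph α β) (e : β) : Prop :=
  kirchhoff G ∈
    Ideal.span (Set.range fun j : β => MvPolynomial.pderiv j (kirchhoff (G.deleteEdges {e})))

/-- The disjoint union of two multigraphs. -/
def disjointUnion {α' β' : Type*} (G : Graph α β) (H : Graph α' β') :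
    Graph (α ⊕ α') (β ⊕ β') where
  vertexSet := Sum.inl '' V(G) ∪ Sum.inr '' V(H)
  IsLink e x y :=
    (∃ e' x' y', G.IsLink e' x' y' ∧ e = .inl e' ∧ x = .inl x' ∧ y = .inl y') ∨
    (∃ e' x' y', H.IsLink e' x' y' ∧ e = .inr e' ∧ x = .inr x' ∧ y = .inr y')
  isLink_symm e _ := ⟨by
    rintro x y (⟨e', x', y', h, rfl, rfl, rfl⟩ | ⟨e', x', y', h, rfl, rfl, rfl⟩)
    · exact .inl ⟨_, _, _, h.symm, rfl, rfl, rfl⟩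
    · exact .inr ⟨_, _, _, h.symm, rfl, rfl, rfl⟩⟩
  eq_or_eq_of_isLink_of_isLink := by
    rintro e x y v w (⟨e', x', y', h, rfl, rfl, rfl⟩ | ⟨e', x', y', h, rfl, rfl, rfl⟩)
      (⟨e'', x'', y'', h', he, rfl, rfl⟩ | ⟨e'', x'', y'', h', he, rfl, rfl⟩)
    · cases he
      simpa using h.left_eq_or_eq h'
    · cases he
    · cases he
    · cases he
      simpa using h.left_eq_or_eq h'
  left_mem_of_isLink := by
    rintro e x y (⟨e', x', y', h, rfl, rfl, rfl⟩ | ⟨e', x', y', h, rfl, rfl, rfl⟩)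
    · exact .inl ⟨_, h.left_mem, rfl⟩
    · exact .inr ⟨_, h.left_mem, rfl⟩

end Multigraph

/-! ### Source-terminal graphs, series and parallel joins -/

/-- A source-terminal graph: a multigraph with finitely many edges and two distinct marked
vertices, the source and the terminal. -/
structure STGraph where
  /-- ambient type of vertices -/
  V : Type u
  /-- ambient type of edges -/
  E : Type u
  [fintypeE : Fintype E]
  /-- the underlying multigraph -/
  graph : Graph V E
  /-- the source -/
  src : V
  /-- the terminal -/
  tgt : V
  src_mem : src ∈ V(graph)
  tgt_mem : tgt ∈ V(graph)
  src_ne_tgt : src ≠ tgt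

attribute [instance] STGraph.fintypeE

namespace STGraph

/-- `K₂`: a single edge joining the source to the terminal. -/
def edge : STGraph.{0} where
  V := Bool
  E := Unit
  graph := Graph.banana false true Set.univ
  src := false
  tgt := true
  src_mem := by simp
  tgt_mem := by simp
  src_ne_tgt := by simp

open Classical in
/-- The parallel join: in the disjoint union, the sources are identified and the terminals are
identified. -/
def parallel (G H : STGraph.{u}) : STGraph.{u} where
  V := G.V ⊕ H.V
  E := G.E ⊕ H.E
  graph := (disjointUnion G.graph H.graph).map fun x =>
    if x = .inr H.src then .inl G.src else if x = .inr H.tgt then .inl G.tgt else x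
  src := .inl G.src
  tgt := .inl G.tgt
  src_mem := ⟨.inl G.src, .inl ⟨_, G.src_mem, rfl⟩, by simp⟩
  tgt_mem := ⟨.inl G.tgt, .inl ⟨_, G.tgt_mem, rfl⟩, by simp⟩
  src_ne_tgt := fun h => G.src_ne_tgt (Sum.inl.inj h)

open Classical in
/-- The series join: in the disjoint union, the source of `H` is identified with the terminal of
`G`; the source is that of `G` and the terminal is that of `H`. -/
def series (G H : STGraph.{u}) : STGraph.{u} where
  V := G.V ⊕ H.V
  E := G.E ⊕ H.E
  graph := (disjointUnion G.graph H.graph).map fun x =>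
    if x = .inr H.src then .inl G.tgt else x
  src := .inl G.src
  tgt := .inr H.tgt
  src_mem := ⟨.inl G.src, .inl ⟨_, G.src_mem, rfl⟩, by simp⟩
  tgt_mem := ⟨.inr H.tgt, .inr ⟨_, H.tgt_mem, rfl⟩, by simp [H.src_ne_tgt.symm]⟩
  src_ne_tgt := by simp

/-- The series join of the graphs `H, L₁, L₂, …, Lₖ`, in this order. -/
def seriesList (H : STGraph.{u}) (L : List STGraph.{u}) : STGraph.{u} :=
  L.foldl series H

/-- An isomorphism of source-terminal graphs. -/
structure Iso (G : STGraph) (H : STGraph) where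
  vertexEquiv : V(G.graph) ≃ V(H.graph)
  edgeEquiv : E(G.graph) ≃ E(H.graph)
  isLink_iff : ∀ (e : E(G.graph)) (x y : V(G.graph)), G.graph.IsLink e x y ↔
    H.graph.IsLink (edgeEquiv e) (vertexEquiv x) (vertexEquiv y)
  map_src : vertexEquiv ⟨G.src, G.src_mem⟩ = ⟨H.src, H.src_mem⟩
  map_tgt : vertexEquiv ⟨G.tgt, G.tgt_mem⟩ = ⟨H.tgt, H.tgt_mem⟩

/-- The Kirchhoff polynomial of a source-terminal graph. -/
def psi (G : STGraph) : MvPolynomial G.E ℚ :=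
  kirchhoff G.graph

/-- The Kirchhoff polynomial of the graph with the source and the terminal identified. -/
def phi (G : STGraph) : MvPolynomial G.E ℚ :=
  kirchhoff (identify G.graph G.src G.tgt)

open MvPolynomial in
/-- Simultaneous combination `S(G, e)`. -/
def SimultaneousCombination (G : STGraph) (e : G.E) : Prop :=
  ∃ (A : G.E → MvPolynomial G.E ℚ) (B C : MvPolynomial G.E ℚ),
    G.psi = ∑ j, A j * pderiv j (pderiv e G.psi) + B * pderiv e G.psi ∧
    G.phi = ∑ j, A j * pderiv j (pderiv e G.phi) + C * pderiv e G.phi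

/-- `G` is a path (with at least one edge) from its source to its terminal. -/
def IsPath (G : STGraph) : Prop :=
  ∃ (n : ℕ) (vert : Fin (n + 1) → G.V) (edge : Fin n → G.E),
    Function.Injective vert ∧ Set.range vert = V(G.graph) ∧
    Function.Injective edge ∧ Set.range edge = E(G.graph) ∧
    (∀ i, G.graph.IsLink (edge i) (vert i.castSucc) (vert i.succ)) ∧
    vert 0 = G.src ∧ vert (Fin.last n) = G.tgt

end STGraph

/-! ### Planar embeddings and Hamiltonian faces -/

section Planar

variable {α β : Type*}

/-- A planar embedding of a multigraph: vertices are distinct points of the plane, edges are arcs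
between their ends (closed curves through the vertex for loops), simple apart from their end points,
and an arc meets the vertices and the other arcs only in its end points. -/
structure PlanarEmbedding (G : Graph α β) where
  point : α → ℂ
  arc : β → unitInterval → ℂ
  point_injOn : Set.InjOn point V(G)
  arc_continuous : ∀ e ∈ E(G), Continuous (arc e)
  arc_ends : ∀ e ∈ E(G), ∃ x y, G.IsLink e x y ∧ arc e 0 = point x ∧ arc e 1 = point y
  arc_injOn : ∀ e ∈ E(G), Set.InjOn (arc e) (Set.Ioo 0 1)
  arc_ne_point : ∀ e ∈ E(G), ∀ r ∈ Set.Ioo (0 : unitInterval) 1, ∀ x ∈ V(G), arc e r ≠ point x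
  arc_disjoint : ∀ e ∈ E(G), ∀ f ∈ E(G), e ≠ f →
    Disjoint (arc e '' Set.Ioo 0 1) (arc f '' Set.Ioo 0 1)

/-- The subset of the plane covered by the embedded graph. -/
def PlanarEmbedding.carrier {G : Graph α β} (P : PlanarEmbedding G) : Set ℂ :=
  P.point '' V(G) ∪ ⋃ e ∈ E(G), Set.range (P.arc e)

/-- A face of an embedding: a connected component of the complement of the embedded graph. -/
def PlanarEmbedding.IsFace {G : Graph α β} (P : PlanarEmbedding G) (F : Set ℂ) : Prop :=
  ∃ z ∈ P.carrierᶜ, F = connectedComponentIn P.carrierᶜ z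

/-- A Hamiltonian cycle, of length `n ≥ 2` (for `n = 2` it consists of two parallel edges). -/
structure HamiltonianCycle (G : Graph α β) where
  n : ℕ
  two_le : 2 ≤ n
  vert : ZMod n → α
  edge : ZMod n → β
  vert_injective : Function.Injective vert
  range_vert : Set.range vert = V(G)
  edge_injective : Function.Injective edge
  isLink : ∀ i, G.IsLink (edge i) (vert i) (vert (i + 1))

end Planar

/-- `G` has a planar embedding with a face whose boundary is a Hamiltonian cycle of `G`, such that
the source and the terminal are consecutive (in either order) on this cycle. -/
def STGraph.HasHamiltonianFace (G : STGraph) : Prop :=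
  ∃ (P : PlanarEmbedding G.graph) (F : Set ℂ) (C : HamiltonianCycle G.graph),
    P.IsFace F ∧ frontier F = ⋃ i, Set.range (P.arc (C.edge i)) ∧
    ∃ i, s(C.vert i, C.vert (i + 1)) = s(G.src, G.tgt)

/-! ### Decomposition trees of series-parallel graphs and their duals -/

/-- Decomposition trees: the leaves stand for edges, the interior vertices for series and parallel
joins. -/
inductive DecompTree where
  | leaf : DecompTree
  | ser : DecompTree → DecompTree → DecompTree
  | par : DecompTree → DecompTree → DecompTree

namespace DecompTree

/-- The series-parallel graph associated to a decomposition tree. -/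
def toSTGraph : DecompTree → STGraph.{0}
  | leaf => STGraph.edge
  | ser a b => a.toSTGraph.series b.toSTGraph
  | par a b => a.toSTGraph.parallel b.toSTGraph

/-- Exchange all series joins with parallel joins and vice versa. -/
def dual : DecompTree → DecompTree
  | leaf => leaf
  | ser a b => par a.dual b.dual
  | par a b => ser a.dual b.dual

/-- `D` is a decomposition tree of the source-terminal graph `G`. -/
def IsDecompositionOf (D : DecompTree) (G : STGraph) : Prop :=
  Nonempty (STGraph.Iso D.toSTGraph G)

end DecompTree

end SeriesParallel

end

-- Write (ψ, φ) for the two Kirchhoff polynomials of a source-terminal graph. In disjoint sets of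
-- variables, a series join has the pair (ψψ', ψφ' + φψ') and a parallel join has (ψφ' + φψ', φφ').
-- The algebraic claims can therefore be proved for pairs of polynomials, by induction on a
-- decomposition tree.
--
-- The conditions on the factors of the series join give each of them a Hamiltonian path from source
-- to terminal: the factor is a path, or one removes from a Hamiltonian cycle the edge between
-- source and terminal. These paths concatenate. Conversely, a source-to-terminal Hamiltonian path
-- restricts to both sides of a series join, while in a parallel join it avoids the inside of one
-- side, which is then a bundle of parallel edges. So every decomposition tree is thin
-- (`DecompTree.isThin_of_isTraceable`). As source and terminal are not adjacent, the root is a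
-- series join (`DecompTree.exists_eq_ser`). Dually, in every series join below a parallel root, one
-- side is a path.
--
-- The coefficients A_j form a derivation θ, and S(G, e) says that ψ ≡ θ(∂_e ψ) modulo ∂_e ψ and φ ≡
-- θ(∂_e φ) modulo ∂_e φ. It survives both kinds of join, after θ is corrected by a multiple of the
-- Euler derivation of the other side. An edge without it remains a bridge (∂_e ψ = 0, ∂_e φ = ψ)
-- until the first parallel join above it; there S(G, e) arises because both sides are linked,
-- meaning that some θ has θψ ≡ φ modulo ψ and θφ ≡ 0 modulo φ (`PairBridge.parallel`). Linkedness
-- survives parallel joins and series joins with paths (`PairLinked.parallel`,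
-- `PairLinked.series_path`), which is where thinness is used. The parallel root leaves no bridge.
--
-- Condition 1 follows: ∂_e ψ is the Kirchhoff polynomial of the graph without e, so S(G, e) puts ψ
-- in the ideal of ∂_e ψ and its derivatives. With at least 4 vertices in the dual graph, ∂_e ψ is
-- homogeneous of positive degree, and Euler's formula puts it in its own Jacobian ideal.

universe v

noncomputable section

open scoped Graph

namespace SeriesParallel

open Relation

/-! ### Spanning trees through `ZMod 2`-valued vertex functions. -/

section Potentials

variable {α β α' β' γ : Type*}

/-- `p` is a `ZMod 2`-valued function on the vertices whose variation along each edge of `T` is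
prescribed by `c`. -/
def IsPotential (G : Graph α β) (T : Set β) (c : β → ZMod 2) (p : α → ZMod 2) : Prop :=
  ∀ e ∈ T, ∀ x y, G.IsLink e x y → p x + p y = c e

/-- Among the functions satisfying `P`, every variation along `T` is realised, and
only the constant functions have zero variation. -/
structure IsPotentialTree (G : Graph α β) (T : Set β) (P : (α → ZMod 2) → Prop) : Prop where
  subset : T ⊆ E(G)
  exists_potential : ∀ c, ∃ p, P p ∧ IsPotential G T c p
  eq_of_potential : ∀ p, P p → IsPotential G T 0 p → ∀ x ∈ V(G), ∀ y ∈ V(G), p x = p y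

lemma eq_of_reflTransGen {r : α → α → Prop} {p : α → γ} (h : ∀ x y, r x y → p x = p y) {x y : α}
    (hxy : ReflTransGen r x y) : p x = p y := by
  induction hxy with
  | refl => rfl
  | tail _ hbc ih => exact ih.trans (h _ _ hbc)

lemma zmod_two_eq_of_add_eq_zero {a b : ZMod 2} (h : a + b = 0) : a = b := by
  revert a b; decide

lemma restrict_adj {G : Graph α β} {T : Set β} {x y : α} :
    (G.restrict T).Adj x y ↔ ∃ e ∈ T, G.IsLink e x y := by
  simp [Graph.Adj]

lemma restrict_deleteEdges_adj {G : Graph α β} {T : Set β} {e : β} {x y : α} :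
    ((G.restrict T).deleteEdges {e}).Adj x y ↔ ∃ f ∈ T, f ≠ e ∧ G.IsLink f x y := by
  simp only [Graph.Adj, Graph.deleteEdges_isLink, Graph.restrict_isLink, Set.mem_singleton_iff]
  exact exists_congr fun f => by tauto

open Classical in
/-- The indicator function of the connected component of `x` in `(V, T)`. -/
def componentIndicator (G : Graph α β) (T : Set β) (x y : α) : ZMod 2 :=
  if ReflTransGen (G.restrict T).Adj x y then 1 else 0

lemma isPotential_componentIndicator (G : Graph α β) (T : Set β) (x : α) :
    IsPotential G T 0 (componentIndicator G T x) := by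
  intro e he y z hyz
  have h1 : (G.restrict T).Adj y z := restrict_adj.2 ⟨e, he, hyz⟩
  have : ReflTransGen (G.restrict T).Adj x y ↔ ReflTransGen (G.restrict T).Adj x z :=
    ⟨fun h => h.tail h1, fun h => h.tail h1.symm⟩
  by_cases hx : ReflTransGen (G.restrict T).Adj x y
  · simp [componentIndicator, hx, this.1 hx, CharTwo.add_self_eq_zero]
  · simp [componentIndicator, hx, mt this.2 hx]

lemma IsPotential.eq_of_reflTransGen {G : Graph α β} {T : Set β} {p : α → ZMod 2}
    (hp : IsPotential G T 0 p) {x y : α} (h : ReflTransGen (G.restrict T).Adj x y) : p x = p y :=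
  SeriesParallel.eq_of_reflTransGen (fun _ _ hab => by
    obtain ⟨e, he, hl⟩ := restrict_adj.1 hab
    exact zmod_two_eq_of_add_eq_zero (hp e he _ _ hl)) h

/-- Vertices in different components are separated by a component indicator, which has zero
variation. -/
lemma isConnected_restrict_iff (G : Graph α β) (T : Set β) :
    IsConnected (G.restrict T) ↔ V(G).Nonempty ∧
      ∀ p, IsPotential G T 0 p → ∀ x ∈ V(G), ∀ y ∈ V(G), p x = p y := by
  refine and_congr Iff.rfl ⟨fun h p hp x hx y hy => hp.eq_of_reflTransGen (h x hx y hy),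
    fun h x hx y hy => ?_⟩
  have := h _ (isPotential_componentIndicator G T x) x hx y hy
  by_contra hcon
  simp [componentIndicator, hcon, ReflTransGen.refl] at this

lemma exists_isPotential_of_isAcyclic (G : Graph α β) {T : Set β} (hT : T.Finite)
    (h : IsAcyclic (G.restrict T)) (c : β → ZMod 2) : ∃ p, IsPotential G T c p := by
  induction T, hT using Set.Finite.induction_on with
  | empty => exact ⟨0, fun e he => he.elim⟩
  | @insert e T he hT ih =>
    obtain ⟨p, hp⟩ := ih fun f x y hf hxy => h f x y
      (by simp only [Graph.restrict_isLink, Set.mem_insert_iff] at hf ⊢; exact ⟨.inr hf.1, hf.2⟩)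
      (ReflTransGen.mono (fun a b hab => by
        rw [restrict_deleteEdges_adj] at hab ⊢
        obtain ⟨f, hf, hab⟩ := hab
        exact ⟨f, .inr hf, hab⟩) _ _ hxy)
    by_cases hgood : ∀ x y, G.IsLink e x y → p x + p y = c e
    · refine ⟨p, fun f hf x y hxy => ?_⟩
      rcases hf with rfl | hf
      exacts [hgood x y hxy, hp f hf x y hxy]
    push Not at hgood
    obtain ⟨x, y, hxy, hne⟩ := hgood
    have hnot : ¬ ReflTransGen (G.restrict T).Adj x y := fun hr =>
      h e x y (by simp [hxy]) (ReflTransGen.mono (fun a b hab => by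
        rw [restrict_deleteEdges_adj]
        obtain ⟨f, hf, hab⟩ := restrict_adj.1 hab
        exact ⟨f, .inr hf, fun hfe => he (hfe ▸ hf), hab⟩) _ _ hr)
    have hx : componentIndicator G T x x = 1 := by simp [componentIndicator, ReflTransGen.refl]
    have hy : componentIndicator G T x y = 0 := by simp [componentIndicator, hnot]
    -- The component of `x` in `T` does not contain `y`, so adding its indicator flips the variation
    -- along the new edge and changes none along `T`.
    refine ⟨fun z => p z + componentIndicator G T x z, fun f hf a b hab => ?_⟩
    rcases hf with rfl | hf
    · have key : p x + 1 + p y = c f := by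
        generalize p x = u, p y = v, c f = w at hne ⊢
        revert u v w; decide
      rcases hxy.eq_and_eq_or_eq_and_eq hab with ⟨rfl, rfl⟩ | ⟨rfl, rfl⟩
      · simpa only [hx, hy, add_zero] using key
      · rw [add_comm]
        simpa only [hx, hy, add_zero] using key
    · have h1 := hp f hf a b hab
      have h2 := isPotential_componentIndicator G T x f hf a b hab
      simp only [Pi.zero_apply] at h2
      rw [add_add_add_comm, h1, h2, add_zero]

lemma isAcyclic_restrict_iff (G : Graph α β) {T : Set β} (hT : T.Finite) :
    IsAcyclic (G.restrict T) ↔ ∀ c, ∃ p, IsPotential G T c p := by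
  classical
  refine ⟨exists_isPotential_of_isAcyclic G hT, fun h e x y hxy hr => ?_⟩
  -- A function varying along `e` only is constant on walks avoiding `e`, yet differs at the two
  -- ends of `e`.
  obtain ⟨p, hp⟩ := h (Pi.single e 1)
  have h1 : p x = p y := eq_of_reflTransGen (fun a b hab => by
    obtain ⟨f, hf, hfe, hl⟩ := restrict_deleteEdges_adj.1 hab
    exact zmod_two_eq_of_add_eq_zero ((hp f hf a b hl).trans (by simp [hfe]))) hr
  have h2 := hp e hxy.1 x y hxy.2
  rw [h1, Pi.single_eq_same] at h2
  generalize p y = u at h2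
  revert u; decide

/-- For the coboundary map from vertex functions to functions on `T`, acyclic means surjective and
connected means that the kernel is the constants. Modulo 2 no orientation is needed, and this form
pulls back along identifications of vertices. -/
lemma isSpanningTree_iff (G : Graph α β) (hG : V(G).Nonempty) {T : Set β} (hT : T.Finite) :
    IsSpanningTree G T ↔ IsPotentialTree G T fun _ => True := by
  rw [IsSpanningTree, isConnected_restrict_iff, isAcyclic_restrict_iff G hT]
  exact ⟨fun ⟨h1, ⟨_, h2⟩, h3⟩ => ⟨h1, by simpa using h3, by simpa using h2⟩,
    fun ⟨h1, h2, h3⟩ => ⟨h1, ⟨hG, by simpa using h3⟩, by simpa using h2⟩⟩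

lemma isPotential_map (G : Graph α β) (f : α → γ) (T : Set β) (c : β → ZMod 2) (q : γ → ZMod 2) :
    IsPotential (G.map f) T c q ↔ IsPotential G T c (q ∘ f) := by
  constructor
  · intro h e he x y hxy
    exact h e he _ _ (hxy.map f)
  · intro h e he x y hxy
    simp only [Graph.map_isLink] at hxy
    obtain ⟨x', y', h', rfl, rfl⟩ := hxy
    exact h e he _ _ h'

/-- Functions on a quotient are the functions upstairs that agree on identified vertices. Quotients
are thus replaced by a side condition `P` on the original graph. -/
lemma isSpanningTree_map_iff (G : Graph α β) (hG : V(G).Nonempty) {T : Set β} (hT : T.Finite)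
    (f : α → γ) {P : (α → ZMod 2) → Prop} (hP : ∀ p, P p ↔ ∃ q : γ → ZMod 2, q ∘ f = p) :
    IsSpanningTree (G.map f) T ↔ IsPotentialTree G T P := by
  rw [isSpanningTree_iff _ (by simpa using hG) hT]
  constructor
  · rintro ⟨h1, h2, h3⟩
    refine ⟨by simpa using h1, fun c => ?_, fun p hp hp0 x hx y hy => ?_⟩
    · obtain ⟨q, -, hq⟩ := h2 c
      exact ⟨q ∘ f, (hP _).2 ⟨q, rfl⟩, (isPotential_map ..).1 hq⟩
    · obtain ⟨q, rfl⟩ := (hP p).1 hp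
      exact h3 q trivial ((isPotential_map ..).2 hp0) _ ⟨x, hx, rfl⟩ _ ⟨y, hy, rfl⟩
  · rintro ⟨h1, h2, h3⟩
    refine ⟨by simpa using h1, fun c => ?_, fun q _ hq0 x hx y hy => ?_⟩
    · obtain ⟨p, hp, hpc⟩ := h2 c
      obtain ⟨q, rfl⟩ := (hP p).1 hp
      exact ⟨q, trivial, (isPotential_map ..).2 hpc⟩
    · simp only [Graph.vertexSet_map] at hx hy
      obtain ⟨x, hx, rfl⟩ := hx
      obtain ⟨y, hy, rfl⟩ := hy
      exact h3 _ ((hP _).2 ⟨q, rfl⟩) ((isPotential_map ..).1 hq0) x hx y hy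

lemma isPotential_disjointUnion (G : Graph α β) (H : Graph α' β') (T : Set (β ⊕ β'))
    (c : β ⊕ β' → ZMod 2) (p : α ⊕ α' → ZMod 2) :
    IsPotential (disjointUnion G H) T c p ↔
      IsPotential G (Sum.inl ⁻¹' T) (c ∘ Sum.inl) (p ∘ Sum.inl) ∧
      IsPotential H (Sum.inr ⁻¹' T) (c ∘ Sum.inr) (p ∘ Sum.inr) := by
  constructor
  · intro h
    exact ⟨fun e he x y hxy => h _ he _ _ (.inl ⟨e, x, y, hxy, rfl, rfl, rfl⟩),
      fun e he x y hxy => h _ he _ _ (.inr ⟨e, x, y, hxy, rfl, rfl, rfl⟩)⟩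
  · rintro ⟨h1, h2⟩ e he x y (⟨e, x, y, hxy, rfl, rfl, rfl⟩ | ⟨e, x, y, hxy, rfl, rfl, rfl⟩)
    exacts [h1 e he x y hxy, h2 e he x y hxy]

lemma edgeSet_disjointUnion (G : Graph α β) (H : Graph α' β') :
    E(disjointUnion G H) = Sum.inl '' E(G) ∪ Sum.inr '' E(H) := by
  ext e
  simp only [Graph.edge_mem_iff_exists_isLink, disjointUnion, Set.mem_union, Set.mem_image]
  constructor
  · rintro ⟨x, y, ⟨e, x, y, h, rfl, rfl, rfl⟩ | ⟨e, x, y, h, rfl, rfl, rfl⟩⟩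
    exacts [.inl ⟨e, ⟨x, y, h⟩, rfl⟩, .inr ⟨e, ⟨x, y, h⟩, rfl⟩]
  · rintro (⟨e, ⟨x, y, h⟩, rfl⟩ | ⟨e, ⟨x, y, h⟩, rfl⟩)
    exacts [⟨_, _, .inl ⟨e, x, y, h, rfl, rfl, rfl⟩⟩, ⟨_, _, .inr ⟨e, x, y, h, rfl, rfl, rfl⟩⟩]

lemma subset_edgeSet_disjointUnion_iff (G : Graph α β) (H : Graph α' β') (T : Set (β ⊕ β')) :
    T ⊆ E(disjointUnion G H) ↔ Sum.inl ⁻¹' T ⊆ E(G) ∧ Sum.inr ⁻¹' T ⊆ E(H) := by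
  rw [edgeSet_disjointUnion]
  constructor
  · intro h
    exact ⟨fun e he => by simpa using h he, fun e he => by simpa using h he⟩
  · rintro ⟨h1, h2⟩ (e | e) he
    exacts [.inl ⟨e, h1 he, rfl⟩, .inr ⟨e, h2 he, rfl⟩]

lemma IsPotential.add_const {G : Graph α β} {T : Set β} {c : β → ZMod 2} {p : α → ZMod 2}
    (h : IsPotential G T c p) (a : ZMod 2) : IsPotential G T c (fun x => p x + a) := by
  intro e he x y hxy
  rw [← h e he x y hxy, add_add_add_comm, CharTwo.add_self_eq_zero, add_zero]

lemma IsPotential.add {G : Graph α β} {T : Set β} {c d : β → ZMod 2} {p q : α → ZMod 2}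
    (h : IsPotential G T c p) (h' : IsPotential G T d q) :
    IsPotential G T (c + d) (fun x => p x + q x) := by
  intro e he x y hxy
  rw [add_add_add_comm, h e he x y hxy, h' e he x y hxy, Pi.add_apply]

lemma isPotential_const (G : Graph α β) (T : Set β) (a : ZMod 2) :
    IsPotential G T 0 (fun _ => a) := fun _ _ _ _ _ => CharTwo.add_self_eq_zero a

/-- Gluing two graphs at one vertex. -/
lemma isPotentialTree_disjointUnion_one (G : Graph α β) (H : Graph α' β') (T : Set (β ⊕ β'))
    {g : α} {h : α'} (hg : g ∈ V(G)) (hh : h ∈ V(H)) {P : (α → ZMod 2) → Prop}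
    {Q : (α' → ZMod 2) → Prop} (hQ : ∀ p a, Q p → Q fun x => p x + a) (hP0 : ∀ a, P fun _ => a) (hQ0 : ∀ a, Q fun _ => a) :
    IsPotentialTree (disjointUnion G H) T
      (fun p => P (p ∘ Sum.inl) ∧ Q (p ∘ Sum.inr) ∧ p (.inl g) = p (.inr h)) ↔
    IsPotentialTree G (Sum.inl ⁻¹' T) P ∧ IsPotentialTree H (Sum.inr ⁻¹' T) Q := by
  constructor
  · rintro ⟨h1, h2, h3⟩
    rw [subset_edgeSet_disjointUnion_iff] at h1
    refine ⟨⟨h1.1, fun c => ?_, fun p hp hp0 x hx y hy => ?_⟩,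
      ⟨h1.2, fun c => ?_, fun p hp hp0 x hx y hy => ?_⟩⟩
    · obtain ⟨p, hp, hpc⟩ := h2 (Sum.elim c 0)
      exact ⟨_, hp.1, ((isPotential_disjointUnion ..).1 hpc).1⟩
    · exact h3 (Sum.elim p fun _ => p g) ⟨hp, hQ0 _, rfl⟩
        ((isPotential_disjointUnion ..).2 ⟨hp0, isPotential_const _ _ _⟩)
        _ (.inl ⟨x, hx, rfl⟩) _ (.inl ⟨y, hy, rfl⟩)
    · obtain ⟨p, hp, hpc⟩ := h2 (Sum.elim 0 c)
      exact ⟨_, hp.2.1, ((isPotential_disjointUnion ..).1 hpc).2⟩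
    · exact h3 (Sum.elim (fun _ => p h) p) ⟨hP0 _, hp, rfl⟩
        ((isPotential_disjointUnion ..).2 ⟨isPotential_const _ _ _, hp0⟩)
        _ (.inr ⟨x, hx, rfl⟩) _ (.inr ⟨y, hy, rfl⟩)
  · rintro ⟨⟨h1, h2, h3⟩, ⟨h1', h2', h3'⟩⟩
    refine ⟨(subset_edgeSet_disjointUnion_iff ..).2 ⟨h1, h1'⟩, fun c => ?_, ?_⟩
    · obtain ⟨p, hp, hpc⟩ := h2 (c ∘ Sum.inl)
      obtain ⟨q, hq, hqc⟩ := h2' (c ∘ Sum.inr)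
      refine ⟨Sum.elim p fun x => q x + (p g - q h), ⟨hp, hQ _ _ hq, by simp⟩,
        (isPotential_disjointUnion ..).2 ⟨hpc, hqc.add_const _⟩⟩
    · rintro p ⟨hp, hq, hgh⟩ hp0
      obtain ⟨hp1, hp2⟩ := (isPotential_disjointUnion ..).1 hp0
      have key : ∀ z ∈ V(disjointUnion G H), p z = p (.inl g) := by
        rintro z (⟨x, hx, rfl⟩ | ⟨x, hx, rfl⟩)
        · exact h3 _ hp hp1 x hx g hg
        · exact (h3' _ hq hp2 x hx h hh).trans hgh.symm
      intro x hx y hy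
      rw [key x hx, key y hy]

/-- A tree in the graph with `a` and `b` identified does not join `a` to `b`. -/
lemma IsPotentialTree.exists_ne {G : Graph α β} {T : Set β} {a b : α} (hab : a ≠ b)
    (h : IsPotentialTree G T fun p => p a = p b) :
    ∃ p, IsPotential G T 0 p ∧ p a ≠ p b := by
  classical
  -- The variation of the indicator of `a` along an edge does not depend on the order of the ends.
  -- Adding a function with `p a = p b` and the same variation leaves zero variation but different
  -- values at `a` and `b`.
  have key : ∀ e, ∃ v, ∀ x y, G.IsLink e x y →
      (Pi.single a 1 : α → ZMod 2) x + (Pi.single a 1 : α → ZMod 2) y = v := by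
    intro e
    by_cases hex : ∃ x y, G.IsLink e x y
    · obtain ⟨x, y, hxy⟩ := hex
      refine ⟨(Pi.single a 1 : α → ZMod 2) x + (Pi.single a 1 : α → ZMod 2) y, fun x' y' h' => ?_⟩
      rcases hxy.eq_and_eq_or_eq_and_eq h' with ⟨rfl, rfl⟩ | ⟨rfl, rfl⟩
      exacts [rfl, add_comm _ _]
    · exact ⟨0, fun x y hxy => (hex ⟨x, y, hxy⟩).elim⟩
  choose c hc' using key
  have hc : IsPotential G T c (Pi.single a 1) := fun e _ => hc' e
  obtain ⟨p, hp, hpc⟩ := h.exists_potential c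
  refine ⟨_, (show c + c = 0 from funext fun e => CharTwo.add_self_eq_zero (c e)) ▸ hc.add hpc, ?_⟩
  simp [hab.symm, hp]

/-- Gluing two graphs at two vertices. -/
lemma isPotentialTree_disjointUnion_two_of_left {G : Graph α β} {H : Graph α' β'}
    {T : Set (β ⊕ β')} {a b : α} {a' b' : α'} (ha : a ∈ V(G)) (ha' : a' ∈ V(H)) (hb : b ∈ V(G))
    (hab' : a' ≠ b') (hG : IsPotentialTree G (Sum.inl ⁻¹' T) fun _ => True)
    (hH : IsPotentialTree H (Sum.inr ⁻¹' T) fun p => p a' = p b') :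
    IsPotentialTree (disjointUnion G H) T
      (fun p => p (.inl a) = p (.inr a') ∧ p (.inl b) = p (.inr b')) := by
  refine ⟨(subset_edgeSet_disjointUnion_iff ..).2 ⟨hG.1, hH.1⟩, fun c => ?_, ?_⟩
  · obtain ⟨p, -, hpc⟩ := hG.exists_potential (c ∘ Sum.inl)
    obtain ⟨q, hq, hqc⟩ := hH.exists_potential (c ∘ Sum.inr)
    obtain ⟨r, hr, hrne⟩ := hH.exists_ne hab'
    by_cases hpab : p a = p b
    · exact ⟨Sum.elim p fun x => q x + (p a - q a'), ⟨by simp, by simp [hq, hpab]⟩,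
        (isPotential_disjointUnion ..).2 ⟨hpc, hqc.add_const _⟩⟩
    -- `r` corrects the mismatch at the second gluing point without changing the variation; the
    -- constant matches the first point.
    · refine ⟨Sum.elim p fun x => q x + r x + (p a - q a' - r a'), ⟨by simp, ?_⟩,
        (isPotential_disjointUnion ..).2 ⟨hpc, by simpa using (hqc.add hr).add_const _⟩⟩
      simp only [Sum.elim_inl, Sum.elim_inr, hq]
      generalize p a = p1, p b = p2, q b' = q1, r a' = r1, r b' = r2 at *
      clear * - hpab hrne
      revert p1 p2 q1 r1 r2
      decide
  · rintro p ⟨hpa, hpb⟩ hp0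
    obtain ⟨hp1, hp2⟩ := (isPotential_disjointUnion ..).1 hp0
    have hab := hG.eq_of_potential _ trivial hp1 a ha b hb
    have key : ∀ z ∈ V(disjointUnion G H), p z = p (.inl a) := by
      rintro z (⟨x, hx, rfl⟩ | ⟨x, hx, rfl⟩)
      · exact hG.eq_of_potential _ trivial hp1 x hx a ha
      · refine (hH.eq_of_potential _ ?_ hp2 x hx a' ha').trans hpa.symm
        exact hpa.symm.trans (hab.trans hpb)
    intro x hx y hy
    rw [key x hx, key y hy]

lemma isPotentialTree_disjointUnion_swap {G : Graph α β} {H : Graph α' β'}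
    {T : Set (β ⊕ β')} {P : (α ⊕ α' → ZMod 2) → Prop}
    (h : IsPotentialTree (disjointUnion G H) T P) :
    IsPotentialTree (disjointUnion H G) (Sum.swap ⁻¹' T) (fun p => P (p ∘ Sum.swap)) := by
  have h1 := (subset_edgeSet_disjointUnion_iff ..).1 h.subset
  refine ⟨(subset_edgeSet_disjointUnion_iff ..).2 ⟨h1.2, h1.1⟩, fun c => ?_,
    fun p hp hp0 x hx y hy => ?_⟩
  · obtain ⟨p, hp, hpc⟩ := h.exists_potential (c ∘ Sum.swap)
    refine ⟨p ∘ Sum.swap, by simpa [Function.comp_assoc] using hp, ?_⟩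
    exact (isPotential_disjointUnion ..).2 ((isPotential_disjointUnion ..).1 hpc).symm
  · have hmem : ∀ z ∈ V(disjointUnion H G), z.swap ∈ V(disjointUnion G H) := by
      rintro z (⟨x, hx, rfl⟩ | ⟨x, hx, rfl⟩)
      exacts [.inr ⟨x, hx, rfl⟩, .inl ⟨x, hx, rfl⟩]
    have := h.eq_of_potential _ hp ((isPotential_disjointUnion ..).2
      ((isPotential_disjointUnion ..).1 hp0).symm) _ (hmem x hx) _ (hmem y hy)
    simpa using this

/-- The part of `T` in `G` already joins `a` to `b`, so seen from `H` the graph `G` acts as the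
identification of `a'` with `b'`. -/
lemma isPotentialTree_disjointUnion_two_cases {G : Graph α β} {H : Graph α' β'}
    {T : Set (β ⊕ β')} {a b : α} {a' b' : α'}
    (h : IsPotentialTree (disjointUnion G H) T
      (fun p => p (.inl a) = p (.inr a') ∧ p (.inl b) = p (.inr b')))
    (hG : ∀ p, IsPotential G (Sum.inl ⁻¹' T) 0 p → p a = p b) :
    IsPotentialTree G (Sum.inl ⁻¹' T) (fun _ => True) ∧
      IsPotentialTree H (Sum.inr ⁻¹' T) fun p => p a' = p b' := by
  obtain ⟨h1, h2, h3⟩ := h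
  rw [subset_edgeSet_disjointUnion_iff] at h1
  refine ⟨⟨h1.1, fun c => ?_, fun p _ hp0 x hx y hy => ?_⟩,
    ⟨h1.2, fun c => ?_, fun p hp hp0 x hx y hy => ?_⟩⟩
  · obtain ⟨p, hp, hpc⟩ := h2 (Sum.elim c 0)
    exact ⟨_, trivial, ((isPotential_disjointUnion ..).1 hpc).1⟩
  · have hab := hG p hp0
    exact h3 (Sum.elim p fun _ => p a) ⟨rfl, hab.symm⟩
      ((isPotential_disjointUnion ..).2 ⟨hp0, isPotential_const _ _ _⟩)
      _ (.inl ⟨x, hx, rfl⟩) _ (.inl ⟨y, hy, rfl⟩)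
  · obtain ⟨p, ⟨hpa, hpb⟩, hpc⟩ := h2 (Sum.elim 0 c)
    obtain ⟨hp1, hp2⟩ := (isPotential_disjointUnion ..).1 hpc
    exact ⟨_, hpa.symm.trans ((hG _ hp1).trans hpb), hp2⟩
  · exact h3 (Sum.elim (fun _ => p a') p) ⟨rfl, hp⟩
      ((isPotential_disjointUnion ..).2 ⟨isPotential_const _ _ _, hp0⟩)
      _ (.inr ⟨x, hx, rfl⟩) _ (.inr ⟨y, hy, rfl⟩)

lemma isPotentialTree_disjointUnion_two (G : Graph α β) (H : Graph α' β')
    (T : Set (β ⊕ β')) {a b : α} {a' b' : α'} (ha : a ∈ V(G)) (hb : b ∈ V(G)) (hab : a ≠ b)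
    (ha' : a' ∈ V(H)) (hb' : b' ∈ V(H)) (hab' : a' ≠ b') :
    IsPotentialTree (disjointUnion G H) T
      (fun p => p (.inl a) = p (.inr a') ∧ p (.inl b) = p (.inr b')) ↔
    (IsPotentialTree G (Sum.inl ⁻¹' T) (fun _ => True) ∧
      IsPotentialTree H (Sum.inr ⁻¹' T) fun p => p a' = p b') ∨
    (IsPotentialTree G (Sum.inl ⁻¹' T) (fun p => p a = p b) ∧
      IsPotentialTree H (Sum.inr ⁻¹' T) fun _ => True) := by
  constructor
  · intro h
    have h' : IsPotentialTree (disjointUnion H G) (Sum.swap ⁻¹' T)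
        (fun p => p (.inl a') = p (.inr a) ∧ p (.inl b') = p (.inr b)) := by
      simpa [eq_comm] using isPotentialTree_disjointUnion_swap h
    by_cases hG : ∀ p, IsPotential G (Sum.inl ⁻¹' T) 0 p → p a = p b
    · exact .inl (isPotentialTree_disjointUnion_two_cases h hG)
    by_cases hH : ∀ p, IsPotential H (Sum.inr ⁻¹' T) 0 p → p a' = p b'
    · exact .inr (isPotentialTree_disjointUnion_two_cases h' hH).symm
    push Not at hG hH
    obtain ⟨p, hp, hpab⟩ := hG
    obtain ⟨q, hq, hqab⟩ := hH
    refine (hpab ?_).elim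
    -- If neither side joins its two gluing points, both separating functions differ there by 1, so
    -- a shift glues them into a nonconstant function of zero variation.
    refine h.eq_of_potential (Sum.elim p fun x => q x + (p a - q a')) ⟨by simp, ?_⟩
      ((isPotential_disjointUnion ..).2 ⟨hp, hq.add_const _⟩) _ (.inl ⟨a, ha, rfl⟩)
      _ (.inl ⟨b, hb, rfl⟩)
    simp only [Sum.elim_inl, Sum.elim_inr]
    generalize p a = p1, p b = p2, q a' = q1, q b' = q2 at *
    clear * - hpab hqab
    revert p1 p2 q1 q2
    decide
  · rintro (⟨h1, h2⟩ | ⟨h1, h2⟩)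
    · exact isPotentialTree_disjointUnion_two_of_left ha ha' hb hab' h1 h2
    · have := isPotentialTree_disjointUnion_two_of_left (T := Sum.swap ⁻¹' T) ha' ha hb' hab h2 h1
      simpa [eq_comm, ← Set.preimage_comp] using isPotentialTree_disjointUnion_swap this

lemma not_isPotentialTree_both {G : Graph α β} {T : Set β} {a b : α} (ha : a ∈ V(G))
    (hb : b ∈ V(G)) (hab : a ≠ b) (h : IsPotentialTree G T fun _ => True)
    (h' : IsPotentialTree G T fun p => p a = p b) : False := by
  obtain ⟨p, hp, hne⟩ := h'.exists_ne hab
  exact hne (h.eq_of_potential p trivial hp a ha b hb)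

end Potentials

end SeriesParallel

namespace SeriesParallel

open MvPolynomial

/-! ### Sums of cotree monomials, disjoint unions and derivatives. -/

section TreeSum

variable {α β α' β' γ : Type*}

lemma pderiv_prod_X_of_notMem {e : β} {s : Finset β} (h : e ∉ s) :
    pderiv e (∏ f ∈ s, X f : MvPolynomial β ℚ) = 0 := by
  classical
  refine pderiv_eq_zero_of_notMem_vars fun hmem => h ?_
  have := vars_prod (R := ℚ) (s := s) (fun f => X f) hmem
  simpa using this

lemma isSpanningTree_deleteEdges_iff (G : Graph α β) (e : β) (T : Set β) :
    IsSpanningTree (G.deleteEdges {e}) T ↔ e ∉ T ∧ IsSpanningTree G T := by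
  have key : e ∉ T → (G.deleteEdges {e}).restrict T = G.restrict T := fun he => by
    refine Graph.ext (by simp) fun f x y => ?_
    simp only [Graph.restrict_isLink, Graph.deleteEdges_isLink, Set.mem_singleton_iff]
    constructor
    · tauto
    · rintro ⟨hf, h⟩
      exact ⟨hf, h, fun hfe => he (hfe ▸ hf)⟩
  constructor
  · rintro ⟨h1, h2⟩
    have he : e ∉ T := fun he => by simpa using h1 he
    rw [key he] at h2
    exact ⟨he, fun f hf => (by simpa using h1 hf : f ∈ E(G) ∧ f ≠ e).1, h2⟩
  · rintro ⟨he, h1, h2⟩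
    rw [← key he] at h2
    exact ⟨fun f hf => by simpa using ⟨h1 hf, fun hfe => he (hfe ▸ hf)⟩, h2⟩

lemma coe_toLeft_eq (T : Finset (β ⊕ β')) : (Sum.inl ⁻¹' (T : Set (β ⊕ β'))) = (T.toLeft : Set β) := by
  ext; simp

lemma coe_toRight_eq (T : Finset (β ⊕ β')) :
    (Sum.inr ⁻¹' (T : Set (β ⊕ β'))) = (T.toRight : Set β') := by
  ext; simp

variable [Fintype β] [Fintype β']

open Classical in
/-- The product of the variables of the edges in `E` outside `T`. -/
def cotreeMonomial (E : Set β) (T : Finset β) : MvPolynomial β ℚ :=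
  ∏ e ∈ (Finset.univ : Finset β).filter (fun e : β => e ∈ E ∧ e ∉ T), X e

open Classical in
/-- The sum of the monomials complementary to the sets satisfying `P`. -/
def treeSum (E : Set β) (P : Finset β → Prop) : MvPolynomial β ℚ :=
  ∑ T ∈ (Finset.univ : Finset (Finset β)).filter P, cotreeMonomial E T

lemma kirchhoff_eq_treeSum (G : Graph α β) :
    kirchhoff G = treeSum E(G) fun T => IsSpanningTree G (T : Set β) := rfl

lemma treeSum_congr {E : Set β} {P Q : Finset β → Prop} (h : ∀ T, P T ↔ Q T) :
    treeSum E P = treeSum E Q := by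
  rw [funext fun T => propext (h T)]

lemma treeSum_or {E : Set β} {P Q : Finset β → Prop} (h : ∀ T, P T → Q T → False) :
    treeSum E (fun T => P T ∨ Q T) = treeSum E P + treeSum E Q := by
  classical
  simp only [treeSum]
  rw [← Finset.sum_union (Finset.disjoint_filter.2 fun T _ hP hQ => h T hP hQ)]
  refine Finset.sum_congr ?_ fun _ _ => rfl
  ext T
  simp

lemma cotreeMonomial_disjSum (E : Set β) (E' : Set β') (T : Finset β) (T' : Finset β') :
    cotreeMonomial (Sum.inl '' E ∪ Sum.inr '' E') (T.disjSum T') =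
      rename Sum.inl (cotreeMonomial E T) * rename Sum.inr (cotreeMonomial E' T') := by
  classical
  simp only [cotreeMonomial, Finset.prod_filter, Fintype.prod_sum_type, map_prod]
  congr 1
  · refine Finset.prod_congr rfl fun e _ => ?_
    by_cases h : e ∈ E ∧ e ∉ T <;> simp [h]
  · refine Finset.prod_congr rfl fun e _ => ?_
    by_cases h : e ∈ E' ∧ e ∉ T' <;> simp [h]

lemma treeSum_and (E : Set β) (E' : Set β') (P : Finset β → Prop) (Q : Finset β' → Prop) :
    treeSum (Sum.inl '' E ∪ Sum.inr '' E') (fun T => P T.toLeft ∧ Q T.toRight) =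
      rename Sum.inl (treeSum E P) * rename Sum.inr (treeSum E' Q) := by
  classical
  simp only [treeSum, Finset.sum_filter, map_sum, Finset.sum_mul_sum]
  rw [← Finset.sumEquiv.symm.toEquiv.sum_comp, Fintype.sum_prod_type]
  refine Finset.sum_congr rfl fun T _ => Finset.sum_congr rfl fun T' _ => ?_
  simp only [OrderIso.coe_toEquiv, Finset.sumEquiv_symm_apply,
    Finset.toLeft_disjSum, Finset.toRight_disjSum, cotreeMonomial_disjSum]
  by_cases h : P T <;> by_cases h' : Q T' <;> simp [h, h']

open Classical in
lemma pderiv_cotreeMonomial {E : Set β} {e : β} (he : e ∈ E) (T : Finset β) :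
    pderiv e (cotreeMonomial E T) = if e ∈ T then 0 else cotreeMonomial (E \ {e}) T := by
  split_ifs with h
  · exact pderiv_prod_X_of_notMem (by simp [h])
  · have : (Finset.univ : Finset β).filter (fun f : β => f ∈ E ∧ f ∉ T) =
        insert e ((Finset.univ : Finset β).filter (fun f : β => f ∈ E \ {e} ∧ f ∉ T)) := by
      ext f
      by_cases hf : f = e <;> simp [hf, he, h]
    rw [cotreeMonomial, cotreeMonomial, this, Finset.prod_insert (by simp), pderiv_mul,
      pderiv_prod_X_of_notMem (by simp), pderiv_X_self]
    simp

/-- Trees through `e` contribute monomials free of `X e`; the others lose the factor `X e` and are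
the trees of the graph without `e`. -/
lemma pderiv_kirchhoff (G : Graph α β) {e : β} (he : e ∈ E(G)) :
    pderiv e (kirchhoff G) = kirchhoff (G.deleteEdges {e}) := by
  classical
  simp only [kirchhoff_eq_treeSum, treeSum, map_sum, Finset.sum_filter, apply_ite, map_zero,
    pderiv_cotreeMonomial he, isSpanningTree_deleteEdges_iff, Graph.edgeSet_deleteEdges]
  refine Finset.sum_congr rfl fun T _ => ?_
  by_cases h : e ∈ T <;> simp [h]

end TreeSum

/-! ### Kirchhoff polynomials of series and parallel joins. -/

section Gluing

variable {α β α' β' γ : Type*} [Fintype β] [Fintype β']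

lemma kirchhoff_eq_treeSum_potential (G : Graph α β) (hG : V(G).Nonempty) :
    kirchhoff G = treeSum E(G) fun T => IsPotentialTree G (T : Set β) fun _ => True :=
  treeSum_congr fun T => isSpanningTree_iff G hG T.finite_toSet

lemma kirchhoff_identify (G : Graph α β) {s t : α} (hs : s ∈ V(G)) :
    kirchhoff (identify G s t) =
      treeSum E(G) fun T => IsPotentialTree G (T : Set β) fun p => p s = p t := by
  rw [kirchhoff_eq_treeSum, identify, Graph.edgeSet_map]
  refine treeSum_congr fun T => isSpanningTree_map_iff G ⟨s, hs⟩ T.finite_toSet _ fun p => ?_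
  constructor
  · intro h
    refine ⟨p, funext fun x => ?_⟩
    by_cases hx : x = t <;> simp [hx, h]
  · rintro ⟨q, rfl⟩
    by_cases hs : s = t <;> simp [hs]

lemma kirchhoff_map_disjointUnion (G : Graph α β) (H : Graph α' β') (hG : V(G).Nonempty)
    (f : α ⊕ α' → γ) {P : (α ⊕ α' → ZMod 2) → Prop} (hP : ∀ p, P p ↔ ∃ q : γ → ZMod 2, q ∘ f = p) :
    kirchhoff ((disjointUnion G H).map f) =
      treeSum (Sum.inl '' E(G) ∪ Sum.inr '' E(H)) fun T =>
        IsPotentialTree (disjointUnion G H) (T : Set (β ⊕ β')) P := by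
  rw [kirchhoff_eq_treeSum, Graph.edgeSet_map, edgeSet_disjointUnion]
  obtain ⟨g, hg⟩ := hG
  exact treeSum_congr fun T => isSpanningTree_map_iff (disjointUnion G H)
    ⟨Sum.inl g, Or.inl ⟨g, hg, rfl⟩⟩
    T.finite_toSet _ hP

/-- The Kirchhoff polynomial of two graphs glued at two vertices. -/
lemma kirchhoff_map_disjointUnion_two (G : Graph α β) (H : Graph α' β') (f : α ⊕ α' → γ)
    {a b : α} {a' b' : α'} (ha : a ∈ V(G)) (hb : b ∈ V(G)) (hab : a ≠ b)
    (ha' : a' ∈ V(H)) (hb' : b' ∈ V(H)) (hab' : a' ≠ b')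
    (hf : ∀ p : α ⊕ α' → ZMod 2, (p (.inl a) = p (.inr a') ∧ p (.inl b) = p (.inr b')) ↔
      ∃ q : γ → ZMod 2, q ∘ f = p) :
    kirchhoff ((disjointUnion G H).map f) =
      rename Sum.inl (kirchhoff G) * rename Sum.inr (kirchhoff (identify H a' b')) +
      rename Sum.inl (kirchhoff (identify G a b)) * rename Sum.inr (kirchhoff H) := by
  rw [kirchhoff_map_disjointUnion G H ⟨a, ha⟩ f hf, kirchhoff_eq_treeSum_potential G ⟨a, ha⟩,
    kirchhoff_eq_treeSum_potential H ⟨a', ha'⟩, kirchhoff_identify G ha, kirchhoff_identify H ha',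
    ← treeSum_and, ← treeSum_and, ← treeSum_or]
  · refine treeSum_congr fun T => ?_
    rw [isPotentialTree_disjointUnion_two G H T ha hb hab ha' hb' hab', coe_toLeft_eq,
      coe_toRight_eq]
  · rintro T ⟨h, -⟩ ⟨h', -⟩
    exact not_isPotentialTree_both ha hb hab h h'

/-- The Kirchhoff polynomial of two graphs glued at one vertex. -/
lemma kirchhoff_map_disjointUnion_one (G : Graph α β) (H : Graph α' β') (f : α ⊕ α' → γ)
    {a : α} {a' : α'} (ha : a ∈ V(G)) (ha' : a' ∈ V(H))
    (hf : ∀ p : α ⊕ α' → ZMod 2, p (.inl a) = p (.inr a') ↔ ∃ q : γ → ZMod 2, q ∘ f = p) :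
    kirchhoff ((disjointUnion G H).map f) =
      rename Sum.inl (kirchhoff G) * rename Sum.inr (kirchhoff H) := by
  rw [kirchhoff_map_disjointUnion G H ⟨a, ha⟩ f hf, kirchhoff_eq_treeSum_potential G ⟨a, ha⟩,
    kirchhoff_eq_treeSum_potential H ⟨a', ha'⟩, ← treeSum_and]
  refine treeSum_congr fun T => ?_
  rw [← coe_toLeft_eq, ← coe_toRight_eq, ← isPotentialTree_disjointUnion_one G H T ha ha'
    (by simp) (by simp) (by simp)]
  simp

/-- The Kirchhoff polynomial of two graphs with two identified vertices, glued at these. -/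
lemma kirchhoff_map_disjointUnion_identify (G : Graph α β) (H : Graph α' β') (f : α ⊕ α' → γ)
    {a b : α} {a' b' : α'} (ha : a ∈ V(G)) (ha' : a' ∈ V(H))
    (hf : ∀ p : α ⊕ α' → ZMod 2, (p (.inl a) = p (.inl b) ∧ p (.inr a') = p (.inr b') ∧
      p (.inl a) = p (.inr a')) ↔ ∃ q : γ → ZMod 2, q ∘ f = p) :
    kirchhoff ((disjointUnion G H).map f) =
      rename Sum.inl (kirchhoff (identify G a b)) * rename Sum.inr (kirchhoff (identify H a' b')) := by
  rw [kirchhoff_map_disjointUnion G H ⟨a, ha⟩ f hf, kirchhoff_identify G ha,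
    kirchhoff_identify H ha', ← treeSum_and]
  refine treeSum_congr fun T => ?_
  rw [← coe_toLeft_eq, ← coe_toRight_eq, ← isPotentialTree_disjointUnion_one G H T ha ha'
    (by simp) (by simp) (by simp)]
  simp

lemma kirchhoff_identify_comm (G : Graph α β) {s t : α} (hs : s ∈ V(G)) (ht : t ∈ V(G)) :
    kirchhoff (identify G s t) = kirchhoff (identify G t s) := by
  rw [kirchhoff_identify G hs, kirchhoff_identify G ht]
  simp only [eq_comm]

open Classical in
/-- The vertex identification of the series join. -/
def seriesMap (t : α) (s' : α') (x : α ⊕ α') : α ⊕ α' :=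
  if x = .inr s' then .inl t else x

open Classical in
/-- The vertex identification of the parallel join. -/
def parallelMap (s t : α) (s' t' : α') (x : α ⊕ α') : α ⊕ α' :=
  if x = .inr s' then .inl s else if x = .inr t' then .inl t else x

@[simp] lemma seriesMap_inl (t : α) (s' : α') (x : α) : seriesMap t s' (.inl x) = .inl x := by
  simp [seriesMap]

@[simp] lemma seriesMap_inr_self (t : α) (s' : α') : seriesMap t s' (.inr s') = .inl t := by
  simp [seriesMap]

lemma seriesMap_inr_of_ne (t : α) {s' x : α'} (h : x ≠ s') :
    seriesMap t s' (.inr x) = .inr x := by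
  simp [seriesMap, h]

@[simp] lemma parallelMap_inl (s t : α) (s' t' : α') (x : α) :
    parallelMap s t s' t' (.inl x) = .inl x := by
  simp [parallelMap]

@[simp] lemma parallelMap_inr_src (s t : α) (s' t' : α') :
    parallelMap s t s' t' (.inr s') = .inl s := by
  simp [parallelMap]

lemma parallelMap_inr_tgt (s t : α) {s' t' : α'} (h : s' ≠ t') :
    parallelMap s t s' t' (.inr t') = .inl t := by
  simp [parallelMap, h.symm]

lemma parallelMap_inr_of_ne (s t : α) {s' t' x : α'} (h : x ≠ s') (h' : x ≠ t') :
    parallelMap s t s' t' (.inr x) = .inr x := by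
  simp [parallelMap, h, h']

lemma eq_comp_seriesMap_iff (t : α) (s' : α') (p : α ⊕ α' → γ) :
    p ∘ seriesMap t s' = p ↔ p (.inl t) = p (.inr s') := by
  constructor
  · intro h
    simpa using congr_fun h (.inr s')
  · intro h
    funext x
    rcases x with x | x
    · simp
    · by_cases hx : x = s'
      · simp [hx, h]
      · simp [seriesMap_inr_of_ne t hx]

lemma eq_comp_parallelMap_iff (s t : α) {s' t' : α'} (hst : s' ≠ t') (p : α ⊕ α' → γ) :
    p ∘ parallelMap s t s' t' = p ↔ p (.inl s) = p (.inr s') ∧ p (.inl t) = p (.inr t') := by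
  constructor
  · intro h
    exact ⟨by simpa using congr_fun h (.inr s'),
      by simpa [parallelMap_inr_tgt s t hst] using congr_fun h (.inr t')⟩
  · rintro ⟨h, h'⟩
    funext x
    rcases x with x | x
    · simp
    · by_cases hx : x = s'
      · simp [hx, h]
      by_cases hx' : x = t'
      · simp [hx', h', parallelMap_inr_tgt s t hst]
      · simp [parallelMap_inr_of_ne s t hx hx']

open Classical in
lemma eq_comp_identify_iff (s t : α) (p : α → γ) :
    (p ∘ fun x => if x = t then s else x) = p ↔ p s = p t := by
  constructor
  · intro h
    simpa using congr_fun h t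
  · intro h
    funext x
    by_cases hx : x = t <;> simp [hx, h]

theorem kirchhoff_series (G : Graph α β) (H : Graph α' β') {t : α} {s' : α'} (ht : t ∈ V(G))
    (hs' : s' ∈ V(H)) :
    kirchhoff ((disjointUnion G H).map (seriesMap t s')) =
      rename Sum.inl (kirchhoff G) * rename Sum.inr (kirchhoff H) := by
  refine kirchhoff_map_disjointUnion_one G H _ ht hs' fun p => ?_
  refine ⟨fun h => ⟨p, (eq_comp_seriesMap_iff ..).2 h⟩, ?_⟩
  rintro ⟨q, rfl⟩
  simp

theorem kirchhoff_parallel (G : Graph α β) (H : Graph α' β') {s t : α} {s' t' : α'}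
    (hs : s ∈ V(G)) (ht : t ∈ V(G)) (hst : s ≠ t) (hs' : s' ∈ V(H)) (ht' : t' ∈ V(H))
    (hst' : s' ≠ t') :
    kirchhoff ((disjointUnion G H).map (parallelMap s t s' t')) =
      rename Sum.inl (kirchhoff G) * rename Sum.inr (kirchhoff (identify H s' t')) +
      rename Sum.inl (kirchhoff (identify G s t)) * rename Sum.inr (kirchhoff H) := by
  refine kirchhoff_map_disjointUnion_two G H _ hs ht hst hs' ht' hst' fun p => ?_
  refine ⟨fun h => ⟨p, (eq_comp_parallelMap_iff _ _ hst' _).2 h⟩, ?_⟩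
  rintro ⟨q, rfl⟩
  simp [parallelMap_inr_tgt s t hst']

theorem kirchhoff_identify_series (G : Graph α β) (H : Graph α' β') {s t : α} {s' t' : α'}
    (hs : s ∈ V(G)) (ht : t ∈ V(G)) (hst : s ≠ t) (hs' : s' ∈ V(H)) (ht' : t' ∈ V(H))
    (hst' : s' ≠ t') :
    kirchhoff (identify ((disjointUnion G H).map (seriesMap t s')) (.inl s) (.inr t')) =
      rename Sum.inl (kirchhoff G) * rename Sum.inr (kirchhoff (identify H s' t')) +
      rename Sum.inl (kirchhoff (identify G s t)) * rename Sum.inr (kirchhoff H) := by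
  -- The ring formed is a gluing at two points, `s` with `t'` and `t` with `s'`, so the marked
  -- vertices of `H` appear in reverse order.
  rw [identify, Graph.map_map, kirchhoff_identify_comm H hs' ht']
  refine kirchhoff_map_disjointUnion_two G H _ hs ht hst ht' hs' hst'.symm fun p => ?_
  constructor
  · rintro ⟨h, h'⟩
    refine ⟨p, ?_⟩
    rw [← Function.comp_assoc, (eq_comp_identify_iff ..).2 h, (eq_comp_seriesMap_iff ..).2 h']
  · rintro ⟨q, rfl⟩
    simp [seriesMap_inr_of_ne t hst'.symm]

theorem kirchhoff_identify_parallel (G : Graph α β) (H : Graph α' β') {s t : α} {s' t' : α'}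
    (hs : s ∈ V(G)) (hst : s ≠ t) (hs' : s' ∈ V(H)) (hst' : s' ≠ t') :
    kirchhoff (identify ((disjointUnion G H).map (parallelMap s t s' t')) (.inl s) (.inl t)) =
      rename Sum.inl (kirchhoff (identify G s t)) *
        rename Sum.inr (kirchhoff (identify H s' t')) := by
  rw [identify, Graph.map_map]
  -- All four marked vertices become one: this is a one-point gluing of the two identified graphs.
  refine kirchhoff_map_disjointUnion_identify G H _ hs hs' fun p => ?_
  constructor
  · rintro ⟨h, h', h''⟩
    refine ⟨p, ?_⟩
    rw [← Function.comp_assoc, (eq_comp_identify_iff ..).2 h,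
      (eq_comp_parallelMap_iff _ _ hst' _).2 ⟨h'', h.symm.trans (h''.trans h')⟩]
  · rintro ⟨q, rfl⟩
    simp [parallelMap_inr_tgt s t hst', hst]

end Gluing

namespace STGraph

theorem psi_series (G H : STGraph.{u}) :
    ((G.series H).psi : MvPolynomial (G.E ⊕ H.E) ℚ) =
      rename Sum.inl G.psi * rename Sum.inr H.psi :=
  kirchhoff_series G.graph H.graph G.tgt_mem H.src_mem

theorem phi_series (G H : STGraph.{u}) :
    ((G.series H).phi : MvPolynomial (G.E ⊕ H.E) ℚ) =
      rename Sum.inl G.psi * rename Sum.inr H.phi + rename Sum.inl G.phi * rename Sum.inr H.psi :=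
  kirchhoff_identify_series G.graph H.graph G.src_mem G.tgt_mem G.src_ne_tgt H.src_mem H.tgt_mem
    H.src_ne_tgt

theorem psi_parallel (G H : STGraph.{u}) :
    ((G.parallel H).psi : MvPolynomial (G.E ⊕ H.E) ℚ) =
      rename Sum.inl G.psi * rename Sum.inr H.phi + rename Sum.inl G.phi * rename Sum.inr H.psi :=
  kirchhoff_parallel G.graph H.graph G.src_mem G.tgt_mem G.src_ne_tgt H.src_mem H.tgt_mem
    H.src_ne_tgt

theorem phi_parallel (G H : STGraph.{u}) :
    ((G.parallel H).phi : MvPolynomial (G.E ⊕ H.E) ℚ) =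
      rename Sum.inl G.phi * rename Sum.inr H.phi :=
  kirchhoff_identify_parallel G.graph H.graph G.src_mem G.src_ne_tgt H.src_mem H.src_ne_tgt

end STGraph

/-! ### The base case: a single edge has the pair (1, x). -/

section Edge

lemma finset_unit_eq (T : Finset Unit) : T = ∅ ∨ T = {()} := by
  revert T; decide

lemma isPotentialTree_edge_iff (T : Finset Unit) :
    IsPotentialTree (Graph.banana false true (Set.univ : Set Unit)) T (fun _ => True) ↔
      T = {()} := by
  constructor
  · intro h
    rcases finset_unit_eq T with rfl | rfl
    · have := h.eq_of_potential (fun b => if b then 1 else 0) trivial (by simp [IsPotential])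
        false (by simp) true (by simp)
      simp at this
    · rfl
  · rintro rfl
    refine ⟨by simp, fun c => ⟨fun b => if b then c () else 0, trivial, ?_⟩, ?_⟩
    · rintro e - x y h
      simp only [Graph.banana_isLink, Set.mem_univ, true_and] at h
      rcases h with ⟨rfl, rfl⟩ | ⟨rfl, rfl⟩ <;> simp
    · intro p _ hp x _ y _
      have : p false = p true :=
        zmod_two_eq_of_add_eq_zero (hp () (by simp) false true (by simp))
      cases x <;> cases y <;> simp [this]

lemma isPotentialTree_loop_iff (T : Finset Unit) :
    IsPotentialTree (Graph.banana false true (Set.univ : Set Unit)) T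
      (fun p => p false = p true) ↔ T = ∅ := by
  constructor
  · intro h
    rcases finset_unit_eq T with rfl | rfl
    · rfl
    · obtain ⟨p, hp, hpc⟩ := h.exists_potential 1
      have := hpc () (by simp) false true (by simp)
      rw [hp, CharTwo.add_self_eq_zero] at this
      simp at this
  · rintro rfl
    refine ⟨by simp, fun c => ⟨0, rfl, by simp [IsPotential]⟩, ?_⟩
    intro p hp _ x _ y _
    cases x <;> cases y <;> simp [hp]

lemma treeSum_eq {β : Type*} [Fintype β] (E : Set β) (S : Finset β) :
    treeSum E (fun T => T = S) = cotreeMonomial E S := by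
  exact Finset.sum_eq_single_of_mem S (by simp) fun T hT hne => (hne (by simpa using hT)).elim

lemma kirchhoff_edge : kirchhoff (Graph.banana false true (Set.univ : Set Unit)) = 1 := by
  rw [kirchhoff_eq_treeSum_potential _ (by simp), treeSum_congr isPotentialTree_edge_iff,
    treeSum_eq]
  simp [cotreeMonomial]

lemma kirchhoff_identify_edge :
    kirchhoff (identify (Graph.banana false true (Set.univ : Set Unit)) false true) = X () := by
  rw [kirchhoff_identify _ (by simp), treeSum_congr isPotentialTree_loop_iff, treeSum_eq]
  simp [cotreeMonomial]

theorem psi_edge : (STGraph.edge.psi : MvPolynomial Unit ℚ) = 1 := kirchhoff_edge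

theorem phi_edge : (STGraph.edge.phi : MvPolynomial Unit ℚ) = X () := kirchhoff_identify_edge

end Edge

end SeriesParallel

namespace SeriesParallel

open MvPolynomial

/-! ### Derivations of polynomial rings extended to more variables. -/

section Derivations

variable {σ τ υ : Type*}

/-- A derivation of the polynomials in the variables `σ`, extended along `f : σ → υ` by zero on the
other variables. -/
def renameDerivation (f : σ → υ) (θ : Derivation ℚ (MvPolynomial σ ℚ) (MvPolynomial σ ℚ)) :
    Derivation ℚ (MvPolynomial υ ℚ) (MvPolynomial υ ℚ) :=
  mkDerivation ℚ (Function.extend f (fun i => rename f (θ (X i))) 0)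

lemma renameDerivation_rename {f : σ → υ} (hf : f.Injective)
    (θ : Derivation ℚ (MvPolynomial σ ℚ) (MvPolynomial σ ℚ)) (p : MvPolynomial σ ℚ) :
    renameDerivation f θ (rename f p) = rename f (θ p) := by
  induction p using MvPolynomial.induction_on with
  | C a =>
    rw [rename_C, derivation_C, derivation_C, map_zero]
  | add p q hp hq => simp only [map_add, hp, hq]
  | mul_X p i hp =>
    rw [map_mul, Derivation.leibniz, hp, Derivation.leibniz, rename_X, renameDerivation,
      mkDerivation_X, hf.extend_apply]
    simp

lemma renameDerivation_rename_of_ne {f : σ → υ} {g : τ → υ} (hfg : ∀ i j, f i ≠ g j)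
    (θ : Derivation ℚ (MvPolynomial σ ℚ) (MvPolynomial σ ℚ)) (p : MvPolynomial τ ℚ) :
    renameDerivation f θ (rename g p) = 0 := by
  induction p using MvPolynomial.induction_on with
  | C a => rw [rename_C, derivation_C]
  | add p q hp hq => simp only [map_add, hp, hq, add_zero]
  | mul_X p i hp =>
    rw [map_mul, Derivation.leibniz, hp, rename_X, renameDerivation, mkDerivation_X,
      Function.extend_apply' _ _ _ (by rintro ⟨j, hj⟩; exact hfg j i hj)]
    simp

lemma pderiv_rename_of_ne {g : τ → υ} {i : υ} (h : ∀ j, i ≠ g j) (p : MvPolynomial τ ℚ) :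
    pderiv i (rename g p) = 0 := by
  induction p using MvPolynomial.induction_on with
  | C a => rw [rename_C, derivation_C]
  | add p q hp hq => simp only [map_add, hp, hq, add_zero]
  | mul_X p j hp =>
    rw [map_mul, Derivation.leibniz, hp, rename_X, pderiv_X_of_ne (h j).symm]
    simp

lemma derivation_apply_eq_sum [Fintype σ]
    (θ : Derivation ℚ (MvPolynomial σ ℚ) (MvPolynomial σ ℚ)) (p : MvPolynomial σ ℚ) :
    θ p = ∑ i, θ (X i) * pderiv i p := by
  classical
  induction p using MvPolynomial.induction_on with
  | C a => simp only [derivation_C, mul_zero, Finset.sum_const_zero]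
  | add p q hp hq => simp only [map_add, hp, hq, mul_add, Finset.sum_add_distrib]
  | mul_X p j hp =>
    simp only [Derivation.leibniz, hp, smul_eq_mul, pderiv_X, Pi.single_apply, mul_add,
      Finset.sum_add_distrib, mul_ite, mul_one, mul_zero, Finset.sum_ite_eq, Finset.mem_univ,
      if_true, Finset.mul_sum]
    congr 1
    · simp [mul_comm]
    · exact Finset.sum_congr rfl fun i _ => by ring

/-- The Euler derivation. It has weights `n` and `n + 1` on the two polynomials of a pair, and this
difference of one is what absorbs discrepancies between the coefficients `B` and `C`. -/
lemma exists_derivation_of_isHomogeneous [Fintype σ] : ∃ η : Derivation ℚ (MvPolynomial σ ℚ)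
    (MvPolynomial σ ℚ), ∀ p (n : ℕ), p.IsHomogeneous n → η p = n * p := by
  refine ⟨mkDerivation ℚ X, fun p n hp => ?_⟩
  rw [derivation_apply_eq_sum]
  simpa using hp.sum_X_mul_pderiv

end Derivations

/-! ### Behaviour of linked pairs, bridges and simultaneous combinations under joins. -/

section Combinations

variable {σ τ υ : Type*}

/-- Simultaneous combination for a pair of polynomials, in terms of a derivation. -/
def PairCombination (e : σ) (ψ φ : MvPolynomial σ ℚ) : Prop :=
  ∃ (θ : Derivation ℚ (MvPolynomial σ ℚ) (MvPolynomial σ ℚ)) (B C : MvPolynomial σ ℚ),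
    ψ = θ (pderiv e ψ) + B * pderiv e ψ ∧ φ = θ (pderiv e φ) + C * pderiv e φ

/-- Some derivation maps `ψ` to `φ` modulo `ψ` and `φ` to `0` modulo `φ`. -/
def PairLinked (ψ φ : MvPolynomial σ ℚ) : Prop :=
  ∃ (θ : Derivation ℚ (MvPolynomial σ ℚ) (MvPolynomial σ ℚ)) (B C : MvPolynomial σ ℚ),
    θ ψ = φ - B * ψ ∧ θ φ = C * φ

/-- The edge `e` is a bridge separating the source from the terminal. -/
def PairBridge (e : σ) (ψ φ : MvPolynomial σ ℚ) : Prop :=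
  pderiv e ψ = 0 ∧ pderiv e φ = ψ

/-- The polynomials of a path from the source to the terminal. -/
def PairPath (ψ φ : MvPolynomial σ ℚ) : Prop :=
  ψ = 1 ∧ ∃ θ : Derivation ℚ (MvPolynomial σ ℚ) (MvPolynomial σ ℚ), θ φ = 1

/-- Homogeneity of the polynomials of a source-terminal graph with cycle rank `n`. -/
def PairHomogeneous (n : ℕ) (ψ φ : MvPolynomial σ ℚ) : Prop :=
  ψ.IsHomogeneous n ∧ φ.IsHomogeneous (n + 1)

variable {f : σ → υ} {g : τ → υ} {ψ φ : MvPolynomial σ ℚ} {ψ' φ' : MvPolynomial τ ℚ} {e : σ}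

lemma PairPath.series (hf : f.Injective) (hfg : ∀ i j, f i ≠ g j) (h : PairPath ψ φ)
    (h' : PairPath ψ' φ') :
    PairPath (rename f ψ * rename g ψ') (rename f ψ * rename g φ' + rename f φ * rename g ψ') := by
  obtain ⟨rfl, θ, hθ⟩ := h
  obtain ⟨rfl, -⟩ := h'
  refine ⟨by simp, renameDerivation f θ, ?_⟩
  simp [renameDerivation_rename hf, renameDerivation_rename_of_ne hfg, hθ]

lemma PairHomogeneous.series {m n : ℕ} (h : PairHomogeneous m ψ φ) (h' : PairHomogeneous n ψ' φ') :
    PairHomogeneous (m + n) (rename f ψ * rename g ψ')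
      (rename f ψ * rename g φ' + rename f φ * rename g ψ') := by
  refine ⟨h.1.rename_isHomogeneous.mul h'.1.rename_isHomogeneous, .add ?_ ?_⟩
  · exact h.1.rename_isHomogeneous.mul h'.2.rename_isHomogeneous
  · convert h.2.rename_isHomogeneous.mul h'.1.rename_isHomogeneous using 1
    ring

lemma PairHomogeneous.parallel {m n : ℕ} (h : PairHomogeneous m ψ φ)
    (h' : PairHomogeneous n ψ' φ') :
    PairHomogeneous (m + n + 1) (rename f ψ * rename g φ' + rename f φ * rename g ψ')
      (rename f φ * rename g φ') := by
  refine ⟨.add ?_ ?_, ?_⟩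
  · exact h.1.rename_isHomogeneous.mul h'.2.rename_isHomogeneous
  · convert h.2.rename_isHomogeneous.mul h'.1.rename_isHomogeneous using 1
    ring
  · convert h.2.rename_isHomogeneous.mul h'.2.rename_isHomogeneous using 1
    ring

lemma PairCombination.parallel [Fintype τ] (hf : f.Injective) (hg : g.Injective)
    (hfg : ∀ i j, f i ≠ g j) {n : ℕ} (h : PairCombination e ψ φ) (h' : PairHomogeneous n ψ' φ') :
    PairCombination (f e) (rename f ψ * rename g φ' + rename f φ * rename g ψ')
      (rename f φ * rename g φ') := by
  obtain ⟨θ, B, C, h1, h2⟩ := h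
  obtain ⟨η, hη⟩ := exists_derivation_of_isHomogeneous (σ := τ)
  have h3 := hη _ _ h'.1
  have h4 := hη _ _ h'.2
  have hgf : ∀ i j, g i ≠ f j := fun i j => (hfg j i).symm
  have h1' := congr_arg (rename f) h1
  have h2' := congr_arg (rename f) h2
  simp only [map_add, map_mul] at h1' h2'
  -- Under `θ` alone the error terms are `B` times `∂ψ φ'` and `C` times `∂φ ψ'`. The Euler term
  -- lowers them by `(B - C)(n + 1)` and `(B - C)n`, which makes them equal.
  refine ⟨renameDerivation f θ + rename f (B - C) • renameDerivation g η,
    rename f B - rename f (B - C) * (n + 1),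
    rename f C - rename f (B - C) * (n + 1), ?_, ?_⟩ <;>
  simp only [map_add, Derivation.leibniz, pderiv_rename hf, pderiv_rename_of_ne (hfg e),
    Derivation.add_apply, Derivation.smul_apply, renameDerivation_rename hf,
    renameDerivation_rename hg, renameDerivation_rename_of_ne hfg,
    renameDerivation_rename_of_ne hgf, h3, h4, smul_eq_mul, map_mul, map_natCast, map_sub,
    mul_zero, zero_add, add_zero, Nat.cast_add, Nat.cast_one, map_one]
  · linear_combination rename g φ' * h1' + rename g ψ' * h2'
  · linear_combination rename g φ' * h2'

lemma PairCombination.series [Fintype τ] (hf : f.Injective) (hg : g.Injective)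
    (hfg : ∀ i j, f i ≠ g j) {n : ℕ} (h : PairCombination e ψ φ) (h' : PairHomogeneous n ψ' φ') :
    PairCombination (f e) (rename f ψ * rename g ψ')
      (rename f ψ * rename g φ' + rename f φ * rename g ψ') := by
  obtain ⟨θ, B, C, h1, h2⟩ := h
  obtain ⟨η, hη⟩ := exists_derivation_of_isHomogeneous (σ := τ)
  have h3 := hη _ _ h'.1
  have h4 := hη _ _ h'.2
  have hgf : ∀ i j, g i ≠ f j := fun i j => (hfg j i).symm
  have h1' := congr_arg (rename f) h1
  have h2' := congr_arg (rename f) h2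
  simp only [map_add, map_mul] at h1' h2'
  -- The same balancing, now for the error terms `B ∂ψ φ'` and `C ∂φ ψ'` in the second polynomial of
  -- the pair.
  refine ⟨renameDerivation f θ + rename f (B - C) • renameDerivation g η,
    rename f B - rename f (B - C) * n,
    rename f C - rename f (B - C) * n, ?_, ?_⟩ <;>
  simp only [map_add, Derivation.leibniz, pderiv_rename hf, pderiv_rename_of_ne (hfg e),
    Derivation.add_apply, Derivation.smul_apply, renameDerivation_rename hf,
    renameDerivation_rename hg, renameDerivation_rename_of_ne hfg,
    renameDerivation_rename_of_ne hgf, h3, h4, smul_eq_mul, map_mul, map_natCast, map_sub,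
    mul_zero, zero_add, add_zero, Nat.cast_add, Nat.cast_one, map_one]
  · linear_combination rename g ψ' * h1'
  · linear_combination rename g φ' * h1' + rename g ψ' * h2'

lemma PairLinked.parallel [Fintype τ] (hf : f.Injective) (hg : g.Injective)
    (hfg : ∀ i j, f i ≠ g j) {n : ℕ} (h : PairLinked ψ φ) (h' : PairHomogeneous n ψ' φ') :
    PairLinked (rename f ψ * rename g φ' + rename f φ * rename g ψ')
      (rename f φ * rename g φ') := by
  obtain ⟨θ, B, C, h1, h2⟩ := h
  obtain ⟨η, hη⟩ := exists_derivation_of_isHomogeneous (σ := τ)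
  have h3 := hη _ _ h'.1
  have h4 := hη _ _ h'.2
  have hgf : ∀ i j, g i ≠ f j := fun i j => (hfg j i).symm
  -- `θ` sends `ψφ' + φψ'` to `φφ' - Bψφ' + Cφψ'`; the Euler weights `n + 1` and `n`, scaled by `B +
  -- C`, equalise the last two coefficients.
  refine ⟨renameDerivation f θ + rename f (B + C) • renameDerivation g η,
    rename f B - rename f (B + C) * (n + 1), rename f C + rename f (B + C) * (n + 1), ?_, ?_⟩ <;>
  simp only [map_add, Derivation.leibniz,
    Derivation.add_apply, Derivation.smul_apply, renameDerivation_rename hf,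
    renameDerivation_rename hg, renameDerivation_rename_of_ne hfg,
    renameDerivation_rename_of_ne hgf, h1, h2, h3, h4, smul_eq_mul, map_mul, map_natCast, map_sub,
    mul_zero, zero_add, add_zero, Nat.cast_add, Nat.cast_one, map_one] <;>
  ring

lemma PairLinked.series_path (hf : f.Injective) (hg : g.Injective)
    (hfg : ∀ i j, f i ≠ g j) (h : PairLinked ψ φ) (h' : PairPath ψ' φ') :
    PairLinked (rename f ψ * rename g ψ')
      (rename f ψ * rename g φ' + rename f φ * rename g ψ') := by
  obtain ⟨θ, B, C, h1, h2⟩ := h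
  obtain ⟨rfl, η, hη⟩ := h'
  have hgf : ∀ i j, g i ≠ f j := fun i j => (hfg j i).symm
  -- With `ψ' = 1` the new pair is `(ψ, ψφ' + φ)`. Being able to prescribe the derivative of `φ'`,
  -- thanks to `η φ' = 1`, supplies the missing term `ψφ'(φ' + B + C)`.
  refine ⟨renameDerivation f θ +
      (rename g φ' * (rename f B + rename g φ' + rename f C)) • renameDerivation g η,
    rename f B + rename g φ', rename g φ' + rename f C, ?_, ?_⟩ <;>
  simp only [map_add, Derivation.leibniz,
    Derivation.add_apply, Derivation.smul_apply, renameDerivation_rename hf,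
    renameDerivation_rename hg, renameDerivation_rename_of_ne hfg,
    renameDerivation_rename_of_ne hgf, h1, h2, hη, smul_eq_mul, map_mul, map_sub,
    mul_zero, zero_add, add_zero, map_one, Derivation.map_one_eq_zero] <;>
  ring

lemma PairBridge.series (hf : f.Injective) (hfg : ∀ i j, f i ≠ g j) (h : PairBridge e ψ φ) :
    PairBridge (f e) (rename f ψ * rename g ψ')
      (rename f ψ * rename g φ' + rename f φ * rename g ψ') := by
  constructor <;>
  simp only [map_add, Derivation.leibniz, pderiv_rename hf, pderiv_rename_of_ne (hfg e), h.1, h.2,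
    smul_eq_mul, mul_zero, zero_add, map_zero]
  ring

/-- The derivatives by `e` of the new pair are `ψψ'` and `ψφ'`. The sum of the two linking
derivations sends them to `φψ' + ψφ'` and `φφ'`, modulo themselves: this is what `PairLinked` is
designed for. -/
lemma PairBridge.parallel (hf : f.Injective) (hg : g.Injective) (hfg : ∀ i j, f i ≠ g j)
    (h : PairBridge e ψ φ) (hl : PairLinked ψ φ) (hl' : PairLinked ψ' φ') :
    PairCombination (f e) (rename f ψ * rename g φ' + rename f φ * rename g ψ')
      (rename f φ * rename g φ') := by
  obtain ⟨θ, B, C, h1, h2⟩ := hl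
  obtain ⟨θ', B', C', h1', h2'⟩ := hl'
  have hgf : ∀ i j, g i ≠ f j := fun i j => (hfg j i).symm
  refine ⟨renameDerivation f θ + renameDerivation g θ',
    rename f B + rename g B', rename f B - rename g C', ?_, ?_⟩ <;>
  simp only [map_add, Derivation.leibniz, pderiv_rename hf, pderiv_rename_of_ne (hfg e), h.1, h.2,
    Derivation.add_apply, renameDerivation_rename hf,
    renameDerivation_rename hg, renameDerivation_rename_of_ne hfg,
    renameDerivation_rename_of_ne hgf, h1, h1', h2', smul_eq_mul, map_mul, map_sub,
    mul_zero, zero_add, add_zero, map_zero] <;>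
  ring

/-- A linked pair for which every edge is a bridge or has a simultaneous combination. -/
def PairGood (ψ φ : MvPolynomial σ ℚ) : Prop :=
  PairLinked ψ φ ∧ ∀ e, PairCombination e ψ φ ∨ PairBridge e ψ φ

/-- The formulas for joins are symmetric in the two sides, which reduces an edge of the second graph
to the case of the first. -/
lemma pair_comm (f : σ → υ) (g : τ → υ) (ψ φ : MvPolynomial σ ℚ) (ψ' φ' : MvPolynomial τ ℚ) :
    rename f ψ * rename g φ' + rename f φ * rename g ψ' =
      rename g ψ' * rename f φ + rename g φ' * rename f ψ := by
  ring

lemma pairCombination_parallel [Fintype σ] [Fintype τ] {m n : ℕ} (h : PairGood ψ φ)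
    (hm : PairHomogeneous m ψ φ) (h' : PairGood ψ' φ') (hn : PairHomogeneous n ψ' φ') (e : σ ⊕ τ) :
    PairCombination e (rename Sum.inl ψ * rename Sum.inr φ' + rename Sum.inl φ * rename Sum.inr ψ')
      (rename Sum.inl φ * rename Sum.inr φ') := by
  rcases e with e | e
  · rcases h.2 e with he | he
    · exact he.parallel Sum.inl_injective Sum.inr_injective (by simp) hn
    · exact he.parallel Sum.inl_injective Sum.inr_injective (by simp) h.1 h'.1
  · rw [pair_comm, mul_comm (rename Sum.inl φ)]
    rcases h'.2 e with he | he
    · exact he.parallel Sum.inr_injective Sum.inl_injective (by simp) hm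
    · exact he.parallel Sum.inr_injective Sum.inl_injective (by simp) h'.1 h.1

lemma PairGood.parallel [Fintype σ] [Fintype τ] {m n : ℕ} (h : PairGood ψ φ)
    (hm : PairHomogeneous m ψ φ) (h' : PairGood ψ' φ') (hn : PairHomogeneous n ψ' φ') :
    PairGood (rename Sum.inl ψ * rename Sum.inr φ' + rename Sum.inl φ * rename Sum.inr ψ')
      (rename Sum.inl φ * rename Sum.inr φ') :=
  ⟨h.1.parallel Sum.inl_injective Sum.inr_injective (by simp) hn,
    fun e => .inl (pairCombination_parallel h hm h' hn e)⟩

lemma PairGood.series [Fintype σ] [Fintype τ] {m n : ℕ} (h : PairGood ψ φ)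
    (hm : PairHomogeneous m ψ φ) (h' : PairGood ψ' φ') (hn : PairHomogeneous n ψ' φ')
    (hp : PairPath ψ φ ∨ PairPath ψ' φ') :
    PairGood (rename Sum.inl ψ * rename Sum.inr ψ')
      (rename Sum.inl ψ * rename Sum.inr φ' + rename Sum.inl φ * rename Sum.inr ψ') := by
  have swap : rename Sum.inl ψ * rename Sum.inr φ' + rename Sum.inl φ * rename Sum.inr ψ' =
      rename Sum.inr ψ' * rename Sum.inl φ + rename Sum.inr φ' * rename Sum.inl ψ :=
    pair_comm _ _ _ _ _ _
  refine ⟨?_, ?_⟩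
  · rcases hp with hp | hp
    · rw [swap, mul_comm (rename Sum.inl ψ)]
      exact h'.1.series_path Sum.inr_injective Sum.inl_injective (by simp) hp
    · exact h.1.series_path Sum.inl_injective Sum.inr_injective (by simp) hp
  · rintro (e | e)
    · exact (h.2 e).imp (·.series Sum.inl_injective Sum.inr_injective (by simp) hn)
        (·.series Sum.inl_injective (by simp))
    · rw [swap, mul_comm (rename Sum.inl ψ)]
      exact (h'.2 e).imp (·.series Sum.inr_injective Sum.inl_injective (by simp) hm)
        (·.series Sum.inr_injective (by simp))

lemma of_pair_eq (P : MvPolynomial σ ℚ → MvPolynomial σ ℚ → Prop) {ψ φ ψ' φ' : MvPolynomial σ ℚ}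
    (hψ : ψ' = ψ) (hφ : φ' = φ) (h : P ψ φ) : P ψ' φ' := by
  rwa [hψ, hφ]

lemma pairGood_edge : PairGood (1 : MvPolynomial Unit ℚ) (X ()) :=
  ⟨⟨0, X (), 0, by simp, by simp⟩, fun e => .inr ⟨by simp, by simp⟩⟩

lemma pairPath_edge : PairPath (1 : MvPolynomial Unit ℚ) (X ()) :=
  ⟨rfl, pderiv (), by simp⟩

lemma pairHomogeneous_edge : PairHomogeneous 0 (1 : MvPolynomial Unit ℚ) (X ()) :=
  ⟨isHomogeneous_one _ _, isHomogeneous_X _ _⟩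

end Combinations

/-! ### Induction over the dual of a thin decomposition tree. -/

namespace DecompTree

/-- The number of series joins of a decomposition tree. -/
def numSer : DecompTree → ℕ
  | leaf => 0
  | ser a b => a.numSer + b.numSer + 1
  | par a b => a.numSer + b.numSer

/-- In every parallel join, one of the two sides consists of parallel edges only. -/
def IsThin : DecompTree → Prop
  | leaf => True
  | ser a b => a.IsThin ∧ b.IsThin
  | par a b => a.IsThin ∧ b.IsThin ∧ (a.numSer = 0 ∨ b.numSer = 0)

/-- Series joins of `t` become parallel joins in the dual, and each of these raises the cycle rank
by one. -/
lemma pairHomogeneous_dual (t : DecompTree) :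
    PairHomogeneous t.numSer t.dual.toSTGraph.psi t.dual.toSTGraph.phi := by
  induction t with
  | leaf =>
    have := pairHomogeneous_edge
    exact of_pair_eq (PairHomogeneous _) psi_edge phi_edge this
  | ser a b ha hb =>
    have := ha.parallel (f := Sum.inl) (g := Sum.inr) hb
    exact of_pair_eq (PairHomogeneous _) (STGraph.psi_parallel _ _) (STGraph.phi_parallel _ _) this
  | par a b ha hb =>
    have := ha.series (f := Sum.inl) (g := Sum.inr) hb
    exact of_pair_eq (PairHomogeneous _) (STGraph.psi_series _ _) (STGraph.phi_series _ _) this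

/-- A tree with parallel joins only is a bundle of parallel edges, and its dual is a path. -/
lemma pairPath_dual {t : DecompTree} (h : t.numSer = 0) :
    PairPath t.dual.toSTGraph.psi t.dual.toSTGraph.phi := by
  induction t with
  | leaf =>
    have := pairPath_edge
    exact of_pair_eq (PairPath) psi_edge phi_edge this
  | ser a b ha hb => simp [numSer] at h
  | par a b ha hb =>
    simp only [numSer, Nat.add_eq_zero_iff] at h
    have := (ha h.1).series (f := Sum.inl) (g := Sum.inr) Sum.inl_injective (by simp) (hb h.2)
    exact of_pair_eq (PairPath) (STGraph.psi_series _ _) (STGraph.phi_series _ _) this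

lemma pairGood_dual {t : DecompTree} (h : t.IsThin) :
    PairGood t.dual.toSTGraph.psi t.dual.toSTGraph.phi := by
  induction t with
  | leaf =>
    have := pairGood_edge
    exact of_pair_eq (PairGood) psi_edge phi_edge this
  | ser a b ha hb =>
    have := (ha h.1).parallel a.pairHomogeneous_dual (hb h.2) b.pairHomogeneous_dual
    exact of_pair_eq (PairGood) (STGraph.psi_parallel _ _) (STGraph.phi_parallel _ _) this
  | par a b ha hb =>
    have := (ha h.1).series a.pairHomogeneous_dual (hb h.2.1) b.pairHomogeneous_dual
      (h.2.2.imp pairPath_dual pairPath_dual)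
    exact of_pair_eq (PairGood) (STGraph.psi_series _ _) (STGraph.phi_series _ _) this

lemma pairCombination_dual_ser {a b : DecompTree} (ha : a.IsThin) (hb : b.IsThin)
    (e : (ser a b).dual.toSTGraph.E) :
    PairCombination e (ser a b).dual.toSTGraph.psi (ser a b).dual.toSTGraph.phi := by
  have := pairCombination_parallel (pairGood_dual ha) a.pairHomogeneous_dual (pairGood_dual hb)
    b.pairHomogeneous_dual e
  exact of_pair_eq (PairCombination _) (STGraph.psi_parallel _ _) (STGraph.phi_parallel _ _) this

end DecompTree

/-! ### From pairs back to S(G, e) and condition 1. -/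

section Conclusion

lemma STGraph.simultaneousCombination_of_pair (G : STGraph.{u}) {e : G.E}
    (h : PairCombination e G.psi G.phi) : G.SimultaneousCombination e := by
  obtain ⟨θ, B, C, h1, h2⟩ := h
  exact ⟨fun j => θ (X j), B, C, by rw [← derivation_apply_eq_sum]; exact h1,
    by rw [← derivation_apply_eq_sum]; exact h2⟩

lemma mem_span_pderiv_of_isHomogeneous {σ : Type*} [Fintype σ] {p : MvPolynomial σ ℚ} {n : ℕ}
    (hp : p.IsHomogeneous n) (hn : n ≠ 0) :
    p ∈ Ideal.span (Set.range fun j => pderiv j p) := by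
  have h1 : (n : MvPolynomial σ ℚ) * p ∈ Ideal.span (Set.range fun j => pderiv j p) := by
    rw [← nsmul_eq_mul, ← hp.sum_X_mul_pderiv]
    exact Ideal.sum_mem _ fun j _ => Ideal.mul_mem_left _ _ (Ideal.subset_span ⟨j, rfl⟩)
  have h2 := Ideal.mul_mem_left _ (C (n : ℚ)⁻¹) h1
  rwa [← mul_assoc, ← map_natCast (C : ℚ →+* MvPolynomial σ ℚ), ← C_mul,
    inv_mul_cancel₀ (Nat.cast_ne_zero.2 hn), C_1, one_mul] at h2

lemma conditionOne_of_pair {α β : Type*} [Fintype β] (G : Graph α β) {e : β} (he : e ∈ E(G))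
    {φ : MvPolynomial β ℚ} (h : PairCombination e (kirchhoff G) φ) {n : ℕ}
    (hn : (kirchhoff G).IsHomogeneous n) (h2 : 2 ≤ n) : ConditionOne G e := by
  obtain ⟨θ, B, -, h1, -⟩ := h
  rw [ConditionOne, ← pderiv_kirchhoff G he]
  -- `2 ≤ n` makes the degree `n - 1` of the derivative positive, so Euler's formula can be divided
  -- by it.
  have hmem := mem_span_pderiv_of_isHomogeneous (hn.pderiv (i := e)) (by omega)
  generalize pderiv e (kirchhoff G) = p at h1 hmem
  rw [h1]
  refine Ideal.add_mem _ ?_ (Ideal.mul_mem_left _ _ hmem)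
  rw [derivation_apply_eq_sum]
  exact Ideal.sum_mem _ fun j _ => Ideal.mul_mem_left _ _ (Ideal.subset_span ⟨j, rfl⟩)

theorem DecompTree.combination_and_conditionOne {a b : DecompTree} (ha : a.IsThin)
    (hb : b.IsThin) (hab : 2 ≤ (ser a b).numSer) :
    ∀ e ∈ E((ser a b).dual.toSTGraph.graph), (ser a b).dual.toSTGraph.SimultaneousCombination e ∧
      ConditionOne (ser a b).dual.toSTGraph.graph e := fun e he =>
  ⟨STGraph.simultaneousCombination_of_pair _ (pairCombination_dual_ser ha hb e),
    conditionOne_of_pair _ he (pairCombination_dual_ser ha hb e)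
      (pairHomogeneous_dual (ser a b)).1 hab⟩

end Conclusion

end SeriesParallel

namespace SeriesParallel

/-! ### Hamiltonian paths in graphs glued at one or two vertices. -/

section HamiltonianPath

variable {α β α' β' γ δ : Type*}

/-- `f 0, …, f n` is a Hamiltonian path from `s` to `t`. -/
structure IsHamPath (G : Graph α β) (s t : α) (n : ℕ) (f : ℕ → α) : Prop where
  zero : f 0 = s
  last : f n = t
  injOn : ∀ k ≤ n, ∀ m ≤ n, f k = f m → k = m
  adj : ∀ k < n, G.Adj (f k) (f (k + 1))
  surj : ∀ x ∈ V(G), ∃ k ≤ n, f k = x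
  mem : ∀ k ≤ n, f k ∈ V(G)

/-- `G` has a Hamiltonian path from `s` to `t`. -/
def HasHamPath (G : Graph α β) (s t : α) : Prop := ∃ n f, IsHamPath G s t n f

lemma HasHamPath.symm {G : Graph α β} {s t : α} (h : HasHamPath G s t) : HasHamPath G t s := by
  obtain ⟨n, f, h⟩ := h
  refine ⟨n, fun k => f (n - k), ⟨by simpa using h.last, by simpa using h.zero, ?_, ?_, ?_, ?_⟩⟩
  · intro k hk m hm hkm
    have := h.injOn _ (Nat.sub_le n k) _ (Nat.sub_le n m) hkm
    omega
  · intro k hk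
    have := (h.adj (n - (k + 1)) (by omega)).symm
    rwa [show n - (k + 1) + 1 = n - k by omega] at this
  · intro x hx
    obtain ⟨k, hk, rfl⟩ := h.surj x hx
    exact ⟨n - k, Nat.sub_le _ _, by rw [Nat.sub_sub_self hk]⟩
  · exact fun k _ => h.mem _ (Nat.sub_le _ _)

/-- `K` is covered by the copies of `G` and `H` embedded along `i` and `j`. -/
structure IsGluing (G : Graph α β) (H : Graph α' β') (K : Graph γ δ) (i : α → γ) (j : α' → γ) :
    Prop where
  inj_left : i.Injective
  inj_right : j.Injective
  vertexSet_eq : V(K) = i '' V(G) ∪ j '' V(H)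
  adj_iff : ∀ u v, K.Adj u v ↔ Relation.Map G.Adj i i u v ∨ Relation.Map H.Adj j j u v

namespace IsGluing

variable {G : Graph α β} {H : Graph α' β'} {K : Graph γ δ} {i : α → γ} {j : α' → γ}
  {s t : α} {s' t' : α'}

lemma symm (h : IsGluing G H K i j) : IsGluing H G K j i :=
  ⟨h.inj_right, h.inj_left, by rw [h.vertexSet_eq, Set.union_comm],
    fun u v => by rw [h.adj_iff, or_comm]⟩

lemma mem_left (h : IsGluing G H K i j) {x : α} (hx : x ∈ V(G)) : i x ∈ V(K) := by
  rw [h.vertexSet_eq]; exact .inl ⟨x, hx, rfl⟩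

lemma adj_left (h : IsGluing G H K i j) {x y : α} (hxy : G.Adj x y) : K.Adj (i x) (i y) :=
  (h.adj_iff _ _).2 (.inl ⟨x, y, hxy, rfl, rfl⟩)

lemma adj_of_eq (h : IsGluing G H K i j) (hs : i s = j s') (ht : i t = j t') (hst : H.Adj s' t') :
    K.Adj (i s) (i t) := by
  rw [hs, ht]
  exact h.symm.adj_left hst

/-- Concatenation of Hamiltonian paths. -/
lemma hasHamPath (h : IsGluing G H K i j) (hij : ∀ x y, i x = j y ↔ x = t ∧ y = s')
    (hG : HasHamPath G s t) (hH : HasHamPath H s' t') : HasHamPath K (i s) (j t') := by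
  obtain ⟨n, f, hf⟩ := hG
  obtain ⟨m, g, hg⟩ := hH
  have hc : i t = j s' := (hij _ _).2 ⟨rfl, rfl⟩
  obtain ⟨F, hF⟩ : ∃ F : ℕ → γ, F = fun k => if k ≤ n then i (f k) else j (g (k - n)) := ⟨_, rfl⟩
  have hF1 : ∀ k ≤ n, F k = i (f k) := fun k hk => by simp [hF, hk]
  have hF2 : ∀ k, F (n + k) = j (g k) := by
    rintro (_ | k)
    · rw [add_zero, hF1 n le_rfl, hf.last, hg.zero, hc]
    · simp [hF]
  have hcases : ∀ k ≤ n + m, k ≤ n ∨ ∃ l, 0 < l ∧ l ≤ m ∧ k = n + l := fun k hk => by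
    by_cases h : k ≤ n
    exacts [.inl h, .inr ⟨k - n, by omega, by omega, by omega⟩]
  have hmixed : ∀ k ≤ n, ∀ l ≤ m, 0 < l → F k ≠ F (n + l) := by
    intro k hk l hl h0 heq
    rw [hF1 k hk, hF2, hij] at heq
    have := hg.injOn l hl 0 (Nat.zero_le _) (heq.2.trans hg.zero.symm)
    omega
  refine ⟨n + m, F, ⟨by rw [hF1 0 (Nat.zero_le _), hf.zero], by rw [hF2, hg.last], ?_, ?_, ?_, ?_⟩⟩
  · intro k hk l hl hkl
    rcases hcases k hk with hk | ⟨k, hk0, hk', rfl⟩ <;>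
      rcases hcases l hl with hl | ⟨l, hl0, hl', rfl⟩
    · rw [hF1 k hk, hF1 l hl] at hkl
      exact hf.injOn k hk l hl (h.inj_left hkl)
    · exact (hmixed k hk l hl' hl0 hkl).elim
    · exact (hmixed l hl k hk' hk0 hkl.symm).elim
    · rw [hF2, hF2] at hkl
      rw [hg.injOn k hk' l hl' (h.inj_right hkl)]
  · intro k hk
    by_cases hkn : k < n
    · rw [hF1 k hkn.le, hF1 (k + 1) hkn]
      exact h.adj_left (hf.adj k hkn)
    · obtain ⟨l, rfl⟩ := Nat.exists_eq_add_of_le (not_lt.1 hkn)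
      rw [hF2, add_assoc, hF2]
      exact h.symm.adj_left (hg.adj l (by omega))
  · intro x hx
    rw [h.vertexSet_eq] at hx
    rcases hx with ⟨x, hx, rfl⟩ | ⟨x, hx, rfl⟩
    · obtain ⟨k, hk, rfl⟩ := hf.surj x hx
      exact ⟨k, by omega, hF1 k hk⟩
    · obtain ⟨k, hk, rfl⟩ := hg.surj x hx
      exact ⟨n + k, by omega, hF2 k⟩
  · intro k hk
    rcases hcases k hk with hk | ⟨k, -, hk', rfl⟩
    · rw [hF1 k hk]
      exact h.mem_left (hf.mem k hk)
    · rw [hF2]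
      exact h.symm.mem_left (hg.mem k hk')

/-- A Hamiltonian path of a series join restricts to the first graph. -/
lemma hasHamPath_left (h : IsGluing G H K i j) (hij : ∀ x y, i x = j y ↔ x = t ∧ y = s')
    (ht : t ∈ V(G)) (hst' : s' ≠ t') (hK : HasHamPath K (i s) (j t')) : HasHamPath G s t := by
  obtain ⟨n, F, hF⟩ := hK
  -- `k₀` is the only time at the cut vertex, hence the only time at which the path can change
  -- sides.
  obtain ⟨k₀, hk₀, hc⟩ := hF.surj _ (h.mem_left ht)
  have hmeet : ∀ k ≤ n, ∀ x y, F k = i x → F k = j y → k = k₀ := by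
    intro k hk x y hx hy
    refine hF.injOn k hk k₀ hk₀ ?_
    rw [hc, hx, ((hij x y).1 (hx.symm.trans hy)).1]
  have step : ∀ k < n, k ≠ k₀ → F k ∈ Set.range i → F (k + 1) ∈ Set.range i := by
    rintro k hk hne ⟨x, hx⟩
    rcases (h.adj_iff _ _).1 (hF.adj k hk) with ⟨a, b, -, -, hb⟩ | ⟨a, b, -, ha, -⟩
    · exact ⟨b, hb⟩
    · exact (hne (hmeet k hk.le x a hx.symm ha.symm)).elim
  have hle : ∀ k ≤ k₀, F k ∈ Set.range i := by
    intro k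
    induction k with
    | zero => exact fun _ => ⟨s, hF.zero.symm⟩
    | succ k ih => exact fun hk => step k (by omega) (by omega) (ih (by omega))
  -- A return to the first graph after `k₀` could not be undone, but the path ends outside it.
  have hgt : ∀ k ≤ n, k₀ < k → F k ∉ Set.range i := by
    intro k hk hlt hmem
    have key : ∀ m, k ≤ m → m ≤ n → F m ∈ Set.range i := by
      intro m hm
      induction m, hm using Nat.le_induction with
      | base => exact fun _ => hmem
      | succ m hm ih => exact fun hmn => step m (by omega) (by omega) (ih (by omega))
    obtain ⟨x, hx⟩ := key n hk le_rfl
    exact hst' ((hij x t').1 (hx.trans hF.last)).2.symm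
  have : Nonempty α := ⟨s⟩
  choose! g hg using hle
  refine ⟨k₀, g, ⟨?_, ?_, ?_, ?_, ?_, ?_⟩⟩
  · exact h.inj_left ((hg 0 (Nat.zero_le _)).trans hF.zero)
  · exact h.inj_left ((hg k₀ le_rfl).trans hc)
  · intro k hk m hm hkm
    exact hF.injOn k (hk.trans hk₀) m (hm.trans hk₀) (by rw [← hg k hk, ← hg m hm, hkm])
  · intro k hk
    rcases (h.adj_iff _ _).1 (hF.adj k (by omega)) with ⟨a, b, hab, ha, hb⟩ | ⟨a, b, -, ha, hb⟩
    · rw [← hg k hk.le] at ha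
      rw [← hg (k + 1) hk] at hb
      rwa [← h.inj_left ha, ← h.inj_left hb]
    · have h1 := hmeet k (by omega) (g k) a (hg k hk.le).symm ha.symm
      omega
  · intro x hx
    obtain ⟨k, hk, hkx⟩ := hF.surj _ (h.mem_left hx)
    have hkk : k ≤ k₀ := not_lt.1 fun hlt => hgt k hk hlt ⟨x, hkx.symm⟩
    exact ⟨k, hkk, h.inj_left ((hg k hkk).trans hkx)⟩
  · intro k hk
    have hm := hF.mem k (hk.trans hk₀)
    rw [h.vertexSet_eq, ← hg k hk] at hm
    rcases hm with ⟨x, hx, hxk⟩ | ⟨y, hy, hyk⟩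
    · rwa [← h.inj_left hxk]
    · rw [((hij _ _).1 hyk.symm).1]
      exact ht

/-- A Hamiltonian path of a parallel join which starts in the first graph stays there. -/
lemma hasHamPath_of_one_mem (h : IsGluing G H K i j)
    (hij : ∀ x y, i x = j y ↔ (x = s ∧ y = s') ∨ (x = t ∧ y = t')) (hs : s ∈ V(G)) (ht : t ∈ V(G))
    {n : ℕ} {F : ℕ → γ} (hF : IsHamPath K (i s) (i t) n F) (hn : 2 ≤ n)
    (h1 : F 1 ∈ Set.range i) : HasHamPath G s t ∧ V(H) ⊆ {s', t'} := by
  -- The shared vertices are the two ends of the path, so its interior cannot change sides.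
  have hmeet : ∀ k ≤ n, ∀ x y, F k = i x → F k = j y → k = 0 ∨ k = n := by
    intro k hk x y hx hy
    rcases (hij x y).1 (hx.symm.trans hy) with ⟨rfl, -⟩ | ⟨rfl, -⟩
    · exact .inl (hF.injOn k hk 0 (Nat.zero_le _) (hx.trans hF.zero.symm))
    · exact .inr (hF.injOn k hk n le_rfl (hx.trans hF.last.symm))
  have hle : ∀ k ≤ n, F k ∈ Set.range i := by
    intro k
    induction k with
    | zero => exact fun _ => ⟨s, hF.zero.symm⟩
    | succ k ih =>
      intro hk
      rcases Nat.eq_zero_or_pos k with rfl | hpos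
      · exact h1
      rcases (h.adj_iff _ _).1 (hF.adj k hk) with ⟨a, b, -, -, hb⟩ | ⟨a, b, -, ha, -⟩
      · exact ⟨b, hb⟩
      · obtain ⟨x, hx⟩ := ih (by omega)
        have := hmeet k (by omega) x a hx.symm ha.symm
        omega
  have : Nonempty α := ⟨s⟩
  choose! g hg using hle
  refine ⟨⟨n, g, ⟨?_, ?_, ?_, ?_, ?_, ?_⟩⟩, ?_⟩
  · exact h.inj_left ((hg 0 (Nat.zero_le _)).trans hF.zero)
  · exact h.inj_left ((hg n le_rfl).trans hF.last)
  · intro k hk m hm hkm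
    exact hF.injOn k hk m hm (by rw [← hg k hk, ← hg m hm, hkm])
  · intro k hk
    rcases (h.adj_iff _ _).1 (hF.adj k (by omega)) with ⟨a, b, hab, ha, hb⟩ | ⟨a, b, -, ha, hb⟩
    · rw [← hg k hk.le] at ha
      rw [← hg (k + 1) hk] at hb
      rwa [← h.inj_left ha, ← h.inj_left hb]
    -- An edge of `H` between vertices of `G` would join the two ends of the path, forcing `n = 1`.
    · have h1 := hmeet k (by omega) (g k) a (hg k hk.le).symm ha.symm
      have h2 := hmeet (k + 1) hk (g (k + 1)) b (hg (k + 1) hk).symm hb.symm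
      omega
  · intro x hx
    obtain ⟨k, hk, hkx⟩ := hF.surj _ (h.mem_left hx)
    exact ⟨k, hk, h.inj_left ((hg k hk).trans hkx)⟩
  · intro k hk
    have hm := hF.mem k hk
    rw [h.vertexSet_eq, ← hg k hk] at hm
    rcases hm with ⟨x, hx, hxk⟩ | ⟨y, hy, hyk⟩
    · rwa [← h.inj_left hxk]
    · rcases (hij _ _).1 hyk.symm with ⟨h3, -⟩ | ⟨h3, -⟩ <;> rwa [h3]
  · intro y hy
    obtain ⟨k, hk, hky⟩ := hF.surj _ (h.symm.mem_left hy)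
    rcases (hij (g k) y).1 ((hg k hk).trans hky) with ⟨-, rfl⟩ | ⟨-, rfl⟩ <;> simp

lemma subset_of_vertexSet_subset (h : IsGluing G H K i j) (hK : V(K) ⊆ {i s, i t}) :
    V(G) ⊆ {s, t} := fun x hx => by
  rcases hK (h.mem_left hx) with hx | hx
  · exact .inl (h.inj_left hx)
  · exact .inr (h.inj_left hx)

/-- In a parallel join with a Hamiltonian path, one side has no inner vertices. -/
lemma hasHamPath_parallel (h : IsGluing G H K i j)
    (hij : ∀ x y, i x = j y ↔ (x = s ∧ y = s') ∨ (x = t ∧ y = t')) (hs : s ∈ V(G)) (ht : t ∈ V(G))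
    (hs' : s' ∈ V(H)) (ht' : t' ∈ V(H)) (hK : HasHamPath K (i s) (i t)) :
    ((HasHamPath G s t ∨ V(G) ⊆ {s, t}) ∧ V(H) ⊆ {s', t'}) ∨
      ((HasHamPath H s' t' ∨ V(H) ⊆ {s', t'}) ∧ V(G) ⊆ {s, t}) := by
  obtain ⟨n, F, hF⟩ := hK
  have e1 : i s = j s' := (hij _ _).2 (.inl ⟨rfl, rfl⟩)
  have e2 : i t = j t' := (hij _ _).2 (.inr ⟨rfl, rfl⟩)
  by_cases hn : 2 ≤ n
  · have hm := hF.mem 1 (by omega)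
    rw [h.vertexSet_eq] at hm
    rcases hm with ⟨x, -, hx⟩ | ⟨x, -, hx⟩
    · have := h.hasHamPath_of_one_mem hij hs ht hF hn ⟨x, hx⟩
      exact .inl ⟨.inl this.1, this.2⟩
    · rw [e1, e2] at hF
      have := h.symm.hasHamPath_of_one_mem (s := s') (t := t') (s' := s) (t' := t)
        (fun y x => by rw [eq_comm, hij, and_comm, and_comm (a := x = t)]) hs' ht' hF hn ⟨x, hx⟩
      exact .inr ⟨.inl this.1, this.2⟩
  -- A path of length at most one covers only its ends; its edge may come from either side, so only
  -- the absence of inner vertices is claimed.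
  · have hK : V(K) ⊆ {i s, i t} := by
      intro x hx
      obtain ⟨k, hk, rfl⟩ := hF.surj x hx
      have : k = 0 ∨ k = n := by omega
      rcases this with rfl | rfl
      · exact .inl hF.zero
      · exact .inr hF.last
    have h1 := h.subset_of_vertexSet_subset hK
    rw [e1, e2] at hK
    exact .inl ⟨.inr h1, h.symm.subset_of_vertexSet_subset hK⟩

end IsGluing

lemma isGluing_map_disjointUnion (G : Graph α β) (H : Graph α' β') (f : α ⊕ α' → γ)
    (hl : (f ∘ Sum.inl).Injective) (hr : (f ∘ Sum.inr).Injective) :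
    IsGluing G H ((disjointUnion G H).map f) (f ∘ Sum.inl) (f ∘ Sum.inr) := by
  refine ⟨hl, hr, ?_, fun u v => ?_⟩
  · rw [Graph.vertexSet_map]
    simp only [disjointUnion, Set.image_union, Set.image_image, Function.comp_apply]
  · rw [Graph.map_adj]
    simp only [Relation.Map, Graph.Adj, disjointUnion]
    constructor
    · rintro ⟨x, y, ⟨e, ⟨e, x, y, h, rfl, rfl, rfl⟩ | ⟨e, x, y, h, rfl, rfl, rfl⟩⟩, rfl, rfl⟩
      exacts [.inl ⟨x, y, ⟨e, h⟩, rfl, rfl⟩, .inr ⟨x, y, ⟨e, h⟩, rfl, rfl⟩]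
    · rintro (⟨x, y, ⟨e, h⟩, rfl, rfl⟩ | ⟨x, y, ⟨e, h⟩, rfl, rfl⟩)
      exacts [⟨_, _, ⟨_, .inl ⟨e, x, y, h, rfl, rfl, rfl⟩⟩, rfl, rfl⟩,
        ⟨_, _, ⟨_, .inr ⟨e, x, y, h, rfl, rfl, rfl⟩⟩, rfl, rfl⟩]

lemma inl_eq_seriesMap_inr_iff {t x : α} {s' y : α'} :
    Sum.inl x = seriesMap t s' (.inr y) ↔ x = t ∧ y = s' := by
  by_cases hy : y = s'
  · simp [hy]
  · simp [seriesMap_inr_of_ne t hy, hy]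

lemma inl_eq_parallelMap_inr_iff {s t x : α} {s' t' y : α'} (h : s' ≠ t') :
    Sum.inl x = parallelMap s t s' t' (.inr y) ↔ (x = s ∧ y = s') ∨ (x = t ∧ y = t') := by
  by_cases hy : y = s'
  · simp [hy, h]
  by_cases hy' : y = t'
  · simp [hy', parallelMap_inr_tgt s t h, h.symm]
  · simp [parallelMap_inr_of_ne s t hy hy', hy, hy']

lemma seriesMap_comp_inr_injective (t : α) (s' : α') :
    (seriesMap t s' ∘ Sum.inr).Injective := by
  intro x y hxy
  simp only [Function.comp_apply] at hxy
  by_cases hx : x = s'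
  · rw [hx, seriesMap_inr_self, inl_eq_seriesMap_inr_iff] at hxy
    rw [hx, hxy.2]
  · by_cases hy : y = s'
    · rw [hy, seriesMap_inr_self, eq_comm, inl_eq_seriesMap_inr_iff] at hxy
      exact (hx hxy.2).elim
    · simpa [seriesMap_inr_of_ne t hx, seriesMap_inr_of_ne t hy] using hxy

lemma parallelMap_comp_inr_injective {s t : α} {s' t' : α'} (h : s ≠ t) (h' : s' ≠ t') :
    (parallelMap s t s' t' ∘ Sum.inr).Injective := by
  intro x y hxy
  simp only [Function.comp_apply] at hxy
  have key : ∀ z w : α', parallelMap s t s' t' (.inr z) = parallelMap s t s' t' (.inr w) →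
      z = s' ∨ z = t' → z = w := by
    rintro z w hzw (rfl | rfl)
    · rw [parallelMap_inr_src, inl_eq_parallelMap_inr_iff h'] at hzw
      rcases hzw with ⟨-, h1⟩ | ⟨h1, -⟩
      exacts [h1.symm, (h h1).elim]
    · rw [parallelMap_inr_tgt s t h', inl_eq_parallelMap_inr_iff h'] at hzw
      rcases hzw with ⟨h1, -⟩ | ⟨-, h1⟩
      exacts [(h h1.symm).elim, h1.symm]
  by_cases hx : x = s' ∨ x = t'
  · exact key x y hxy hx
  by_cases hy : y = s' ∨ y = t'
  · exact (key y x hxy.symm hy).symm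
  push Not at hx hy
  simpa [parallelMap_inr_of_ne s t hx.1 hx.2, parallelMap_inr_of_ne s t hy.1 hy.2] using hxy

end HamiltonianPath

end SeriesParallel

namespace SeriesParallel

/-! ### Traceability of source-terminal graphs under joins and isomorphisms. -/

namespace STGraph

lemma isGluing_series (G H : STGraph.{u}) : IsGluing G.graph H.graph (G.series H).graph
    (seriesMap G.tgt H.src ∘ Sum.inl) (seriesMap G.tgt H.src ∘ Sum.inr) :=
  isGluing_map_disjointUnion G.graph H.graph (seriesMap G.tgt H.src)
    (fun x y h => by simpa using h) (seriesMap_comp_inr_injective _ _)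

lemma isGluing_parallel (G H : STGraph.{u}) : IsGluing G.graph H.graph (G.parallel H).graph
    (parallelMap G.src G.tgt H.src H.tgt ∘ Sum.inl)
    (parallelMap G.src G.tgt H.src H.tgt ∘ Sum.inr) :=
  isGluing_map_disjointUnion G.graph H.graph (parallelMap G.src G.tgt H.src H.tgt)
    (fun x y h => by simpa using h) (parallelMap_comp_inr_injective G.src_ne_tgt H.src_ne_tgt)

lemma series_meet (G H : STGraph.{u}) (x : G.V) (y : H.V) :
    (seriesMap G.tgt H.src ∘ Sum.inl) x = (seriesMap G.tgt H.src ∘ Sum.inr) y ↔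
      x = G.tgt ∧ y = H.src := by
  simp only [Function.comp_apply, seriesMap_inl, inl_eq_seriesMap_inr_iff]

lemma parallel_meet (G H : STGraph.{u}) (x : G.V) (y : H.V) :
    (parallelMap G.src G.tgt H.src H.tgt ∘ Sum.inl) x =
      (parallelMap G.src G.tgt H.src H.tgt ∘ Sum.inr) y ↔
      (x = G.src ∧ y = H.src) ∨ (x = G.tgt ∧ y = H.tgt) := by
  simp only [Function.comp_apply, parallelMap_inl, inl_eq_parallelMap_inr_iff H.src_ne_tgt]

lemma series_src (G H : STGraph.{u}) :
    (G.series H).src = (seriesMap G.tgt H.src ∘ Sum.inl) G.src :=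
  (seriesMap_inl _ _ _).symm

lemma series_tgt (G H : STGraph.{u}) :
    (G.series H).tgt = (seriesMap G.tgt H.src ∘ Sum.inr) H.tgt :=
  (seriesMap_inr_of_ne _ H.src_ne_tgt.symm).symm

lemma parallel_src (G H : STGraph.{u}) :
    (G.parallel H).src = (parallelMap G.src G.tgt H.src H.tgt ∘ Sum.inl) G.src :=
  (parallelMap_inl _ _ _ _ _).symm

lemma parallel_tgt (G H : STGraph.{u}) :
    (G.parallel H).tgt = (parallelMap G.src G.tgt H.src H.tgt ∘ Sum.inl) G.tgt :=
  (parallelMap_inl _ _ _ _ _).symm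

/-- `G` has a Hamiltonian path from its source to its terminal. -/
def IsTraceable (G : STGraph.{u}) : Prop := HasHamPath G.graph G.src G.tgt

lemma IsTraceable.series {G H : STGraph.{u}} (hG : G.IsTraceable) (hH : H.IsTraceable) :
    (G.series H).IsTraceable := by
  rw [IsTraceable, series_src, series_tgt]
  exact (isGluing_series G H).hasHamPath (series_meet G H) hG hH

lemma IsTraceable.of_series {G H : STGraph.{u}} (h : (G.series H).IsTraceable) :
    G.IsTraceable ∧ H.IsTraceable := by
  rw [IsTraceable, series_src, series_tgt] at h
  refine ⟨(isGluing_series G H).hasHamPath_left (series_meet G H) G.tgt_mem H.src_ne_tgt h, ?_⟩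
  refine ((isGluing_series G H).symm.hasHamPath_left (fun x y => ?_) H.src_mem G.src_ne_tgt.symm
    h.symm).symm
  exact (eq_comm.trans (series_meet G H y x)).trans and_comm

lemma IsTraceable.of_parallel {G H : STGraph.{u}} (h : (G.parallel H).IsTraceable) :
    ((G.IsTraceable ∨ V(G.graph) ⊆ {G.src, G.tgt}) ∧ V(H.graph) ⊆ {H.src, H.tgt}) ∨
      ((H.IsTraceable ∨ V(H.graph) ⊆ {H.src, H.tgt}) ∧ V(G.graph) ⊆ {G.src, G.tgt}) := by
  rw [IsTraceable, parallel_src, parallel_tgt] at h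
  exact (isGluing_parallel G H).hasHamPath_parallel (parallel_meet G H) G.src_mem G.tgt_mem
    H.src_mem H.tgt_mem h

lemma isTraceable_seriesList {H : STGraph.{u}} {L : List STGraph.{u}}
    (h : ∀ K ∈ H :: L, K.IsTraceable) : (H.seriesList L).IsTraceable := by
  induction L generalizing H with
  | nil => exact h H (by simp)
  | cons K L ih =>
    refine ih (H := H.series K) fun M hM => ?_
    rcases List.mem_cons.1 hM with rfl | hM
    · exact (h H (by simp)).series (h K (by simp))
    · exact h M (by simp [hM])

/-- Every edge lies on one side, but the terminal is not a vertex of the first side and the source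
is not one of the second. -/
lemma not_adj_series (G H : STGraph.{u}) :
    ¬ (G.series H).graph.Adj (G.series H).src (G.series H).tgt := by
  rw [series_src, series_tgt]
  intro h
  rcases ((isGluing_series G H).adj_iff _ _).1 h with ⟨x, y, -, -, hy⟩ | ⟨x, y, -, hx, -⟩
  · exact H.src_ne_tgt ((series_meet G H _ _).1 hy).2.symm
  · exact G.src_ne_tgt ((series_meet G H _ _).1 hx.symm).1

lemma adj_parallel_of_left {G H : STGraph.{u}} (h : G.graph.Adj G.src G.tgt) :
    (G.parallel H).graph.Adj (G.parallel H).src (G.parallel H).tgt := by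
  rw [parallel_src, parallel_tgt]
  exact (isGluing_parallel G H).adj_left h

lemma adj_parallel_of_right {G H : STGraph.{u}} (h : H.graph.Adj H.src H.tgt) :
    (G.parallel H).graph.Adj (G.parallel H).src (G.parallel H).tgt := by
  rw [parallel_src, parallel_tgt]
  exact (isGluing_parallel G H).adj_of_eq ((parallel_meet G H _ _).2 (.inl ⟨rfl, rfl⟩))
    ((parallel_meet G H _ _).2 (.inr ⟨rfl, rfl⟩)) h

lemma not_adj_seriesList (H : STGraph.{u}) {L : List STGraph.{u}} (hL : L ≠ []) :
    ¬ (H.seriesList L).graph.Adj (H.seriesList L).src (H.seriesList L).tgt := by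
  obtain ⟨L', K, rfl⟩ : ∃ L' K, L = L' ++ [K] := ⟨_, _, (List.dropLast_append_getLast hL).symm⟩
  rw [seriesList, List.foldl_append]
  exact not_adj_series _ K

lemma IsPath.isTraceable {G : STGraph.{u}} (h : G.IsPath) : G.IsTraceable := by
  obtain ⟨n, vert, edge, hv, hrange, -, -, hlink, h0, hlast⟩ := h
  -- `Fin.ofNat` reduces modulo `n + 1`, which changes nothing for `k ≤ n`.
  refine ⟨n, fun k => vert (Fin.ofNat (n + 1) k), ⟨h0, ?_, ?_, ?_, ?_, ?_⟩⟩
  · rw [← hlast]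
    congr 1
    ext
    simp
  · intro k hk m hm hkm
    have := congr_arg Fin.val (hv hkm)
    simpa [Nat.mod_eq_of_lt (Nat.lt_succ_of_le hk), Nat.mod_eq_of_lt (Nat.lt_succ_of_le hm)]
      using this
  · intro k hk
    refine ⟨edge ⟨k, hk⟩, ?_⟩
    convert hlink ⟨k, hk⟩ using 2
    · ext
      simp only [Fin.val_ofNat, Fin.val_castSucc]
      exact Nat.mod_eq_of_lt (by omega)
    · ext
      simp only [Fin.val_ofNat, Fin.val_succ]
      exact Nat.mod_eq_of_lt (by omega)
  · intro x hx
    rw [← hrange] at hx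
    obtain ⟨i, rfl⟩ := hx
    refine ⟨i, by omega, ?_⟩
    congr 1
    ext
    simp
  · intro k _
    rw [← hrange]
    exact ⟨_, rfl⟩

/-- Go once around the cycle from `i + 1`, omitting the edge with index `i`; the last vertex is
reached after `C.n - 1` steps. -/
lemma hasHamPath_of_hamiltonianCycle {α β : Type*} {G : Graph α β} (C : HamiltonianCycle G)
    (i : ZMod C.n) : HasHamPath G (C.vert (i + 1)) (C.vert i) := by
  have h2 := C.two_le
  have : NeZero C.n := ⟨by omega⟩
  refine ⟨C.n - 1, fun k => C.vert (i + 1 + k), ⟨by simp, ?_, ?_, ?_, ?_, ?_⟩⟩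
  · rw [Nat.cast_sub (by omega)]
    simp
  · intro k hk m hm hkm
    have := congr_arg ZMod.val (add_left_cancel (C.vert_injective hkm))
    rwa [ZMod.val_natCast_of_lt (by omega), ZMod.val_natCast_of_lt (by omega)] at this
  · intro k _
    refine ⟨C.edge (i + 1 + k), ?_⟩
    rw [Nat.cast_add, Nat.cast_one, ← add_assoc]
    exact C.isLink _
  · intro x hx
    rw [← C.range_vert] at hx
    obtain ⟨m, rfl⟩ := hx
    refine ⟨(m - (i + 1)).val, ?_, ?_⟩
    · have := ZMod.val_lt (m - (i + 1))
      omega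
    · simp
  · intro k _
    rw [← C.range_vert]
    exact ⟨_, rfl⟩

lemma HasHamiltonianFace.isTraceable {G : STGraph.{u}} (h : G.HasHamiltonianFace) :
    G.IsTraceable := by
  obtain ⟨-, -, C, -, -, i, hi⟩ := h
  have := hasHamPath_of_hamiltonianCycle C i
  rcases Sym2.eq_iff.1 hi with ⟨h1, h2⟩ | ⟨h1, h2⟩
  · rw [h1, h2] at this
    exact this.symm
  · rwa [h1, h2] at this

namespace Iso

variable {G : STGraph.{u}} {H : STGraph.{v}}

lemma adj_iff (φ : Iso G H) (x y : V(G.graph)) :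
    G.graph.Adj x y ↔ H.graph.Adj (φ.vertexEquiv x) (φ.vertexEquiv y) := by
  constructor
  · rintro ⟨e, he⟩
    exact ⟨_, (φ.isLink_iff ⟨e, he.edge_mem⟩ x y).1 he⟩
  · rintro ⟨e, he⟩
    refine ⟨φ.edgeEquiv.symm ⟨e, he.edge_mem⟩, (φ.isLink_iff _ x y).2 ?_⟩
    rwa [Equiv.apply_symm_apply]

lemma adj_src_tgt_iff (φ : Iso G H) : G.graph.Adj G.src G.tgt ↔ H.graph.Adj H.src H.tgt := by
  have := φ.adj_iff ⟨_, G.src_mem⟩ ⟨_, G.tgt_mem⟩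
  rwa [φ.map_src, φ.map_tgt] at this

lemma ncard_eq (φ : Iso G H) : V(G.graph).ncard = V(H.graph).ncard :=
  Nat.card_congr φ.vertexEquiv

lemma isTraceable (φ : Iso G H) (h : H.IsTraceable) : G.IsTraceable := by
  classical
  obtain ⟨n, f, h⟩ := h
  obtain ⟨g, hg⟩ : ∃ g : ℕ → V(G.graph), ∀ k ≤ n, (φ.vertexEquiv (g k) : H.V) = f k := by
    have : ∀ k, ∃ x : V(G.graph), k ≤ n → (φ.vertexEquiv x : H.V) = f k := fun k => by
      by_cases hk : k ≤ n
      · exact ⟨φ.vertexEquiv.symm ⟨f k, h.mem k hk⟩, fun _ => by simp⟩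
      · exact ⟨⟨_, G.src_mem⟩, fun hk' => (hk hk').elim⟩
    choose g hg using this
    exact ⟨g, hg⟩
  have hinj : ∀ x y : V(G.graph), (φ.vertexEquiv x : H.V) = φ.vertexEquiv y → x = y :=
    fun x y hxy => φ.vertexEquiv.injective (Subtype.ext hxy)
  refine ⟨n, fun k => g k, ⟨?_, ?_, ?_, ?_, ?_, fun k _ => (g k).2⟩⟩
  · refine congr_arg Subtype.val (hinj (g 0) ⟨_, G.src_mem⟩ ?_)
    rw [hg 0 (Nat.zero_le _), h.zero, φ.map_src]
  · refine congr_arg Subtype.val (hinj (g n) ⟨_, G.tgt_mem⟩ ?_)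
    rw [hg n le_rfl, h.last, φ.map_tgt]
  · intro k hk m hm hkm
    exact h.injOn k hk m hm (by rw [← hg k hk, ← hg m hm, Subtype.ext hkm])
  · intro k hk
    rw [φ.adj_iff, hg k hk.le, hg (k + 1) hk]
    exact h.adj k hk
  · intro x hx
    obtain ⟨k, hk, hkx⟩ := h.surj _ (φ.vertexEquiv ⟨x, hx⟩).2
    exact ⟨k, hk, congr_arg Subtype.val (hinj (g k) ⟨x, hx⟩ ((hg k hk).trans hkx))⟩

end Iso

end STGraph

/-! ### From Hamiltonian paths to thin trees with a series root. -/

namespace DecompTree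

open STGraph

/-- A series join creates an inner vertex at the gluing point, whereas a parallel join creates none.
-/
lemma vertexSet_subset_iff (t : DecompTree) :
    V(t.toSTGraph.graph) ⊆ {t.toSTGraph.src, t.toSTGraph.tgt} ↔ t.numSer = 0 := by
  induction t with
  | leaf =>
    refine iff_of_true ?_ rfl
    rintro x hx
    exact hx
  | ser a b _ _ =>
    refine iff_of_false (fun h => ?_) (Nat.succ_ne_zero _)
    have hglue := isGluing_series a.toSTGraph b.toSTGraph
    rcases h (hglue.mem_left a.toSTGraph.tgt_mem) with h1 | h1
    · exact a.toSTGraph.src_ne_tgt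
        (hglue.inj_left (h1.trans (series_src a.toSTGraph b.toSTGraph))).symm
    · have h1 := h1.trans (series_tgt a.toSTGraph b.toSTGraph)
      exact b.toSTGraph.src_ne_tgt ((series_meet a.toSTGraph b.toSTGraph _ _).1 h1).2.symm
  | par a b ha hb =>
    have hglue := isGluing_parallel a.toSTGraph b.toSTGraph
    have e1 := (parallel_meet a.toSTGraph b.toSTGraph _ _).2 (.inl ⟨rfl, rfl⟩)
    have e2 := (parallel_meet a.toSTGraph b.toSTGraph _ _).2 (.inr ⟨rfl, rfl⟩)
    have key : V((a.toSTGraph.parallel b.toSTGraph).graph) ⊆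
        {(a.toSTGraph.parallel b.toSTGraph).src, (a.toSTGraph.parallel b.toSTGraph).tgt} ↔
        a.numSer = 0 ∧ b.numSer = 0 := by
      rw [← ha, ← hb, parallel_src, parallel_tgt]
      constructor
      · intro h
        refine ⟨hglue.subset_of_vertexSet_subset h, ?_⟩
        rw [e1, e2] at h
        exact hglue.symm.subset_of_vertexSet_subset h
      · rintro ⟨h1, h2⟩
        rw [hglue.vertexSet_eq]
        rintro _ (⟨x, hx, rfl⟩ | ⟨x, hx, rfl⟩)
        · rcases h1 hx with hx | hx
          exacts [.inl (congr_arg _ hx), .inr (congr_arg _ hx)]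
        · rcases h2 hx with hx | hx
          exacts [.inl ((congr_arg _ hx).trans e1.symm), .inr ((congr_arg _ hx).trans e2.symm)]
    exact key.trans Nat.add_eq_zero_iff.symm

lemma isThin_of_numSer_eq_zero {t : DecompTree} (h : t.numSer = 0) : t.IsThin := by
  induction t with
  | leaf => trivial
  | ser a b _ _ => exact (Nat.succ_ne_zero _ h).elim
  | par a b ha hb =>
    obtain ⟨h1, h2⟩ := Nat.add_eq_zero_iff.1 h
    exact ⟨ha h1, hb h2, .inl h1⟩

lemma isThin_of_isTraceable {t : DecompTree} (h : t.toSTGraph.IsTraceable) : t.IsThin := by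
  induction t with
  | leaf => trivial
  | ser a b ha hb => exact ⟨ha h.of_series.1, hb h.of_series.2⟩
  | par a b ha hb =>
    have := IsTraceable.of_parallel h
    rw [vertexSet_subset_iff, vertexSet_subset_iff] at this
    rcases this with ⟨h1, h2⟩ | ⟨h1, h2⟩
    · exact ⟨h1.elim ha isThin_of_numSer_eq_zero, isThin_of_numSer_eq_zero h2, .inr h2⟩
    · exact ⟨isThin_of_numSer_eq_zero h2, h1.elim hb isThin_of_numSer_eq_zero, .inl h2⟩

lemma adj_leaf : leaf.toSTGraph.graph.Adj leaf.toSTGraph.src leaf.toSTGraph.tgt :=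
  ⟨(), Set.mem_univ _, .inl ⟨rfl, rfl⟩⟩

lemma adj_of_numSer_eq_zero {t : DecompTree} (h : t.numSer = 0) :
    t.toSTGraph.graph.Adj t.toSTGraph.src t.toSTGraph.tgt := by
  induction t with
  | leaf => exact adj_leaf
  | ser a b _ _ => exact (Nat.succ_ne_zero _ h).elim
  | par a b ha _ => exact adj_parallel_of_left (ha (Nat.add_eq_zero_iff.1 h).1)

/-- A parallel root of a thin tree has a side that is a bundle of parallel edges, which makes source
and terminal adjacent. -/
lemma exists_eq_ser {t : DecompTree} (h : t.IsThin)
    (hadj : ¬ t.toSTGraph.graph.Adj t.toSTGraph.src t.toSTGraph.tgt) : ∃ a b, t = ser a b := by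
  cases t with
  | leaf => exact (hadj adj_leaf).elim
  | ser a b => exact ⟨a, b, rfl⟩
  | par a b =>
    rcases h.2.2 with h | h
    · exact (hadj (adj_parallel_of_left (adj_of_numSer_eq_zero h))).elim
    · exact (hadj (adj_parallel_of_right (adj_of_numSer_eq_zero h))).elim

lemma ncard_le_three_of_subset {α : Type*} {S : Set α} {x y z : α} (h : S ⊆ {x, y, z}) :
    S.ncard ≤ 3 := by
  refine (Set.ncard_le_ncard h (by simp)).trans ((Set.ncard_insert_le _ _).trans
    (Nat.add_le_add_right ((Set.ncard_insert_le _ _).trans ?_) 1))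
  rw [Set.ncard_singleton]

lemma two_le_numSer {a b : DecompTree} (h : 4 ≤ V((ser a b).toSTGraph.graph).ncard) :
    2 ≤ (ser a b).numSer := by
  by_contra hlt
  simp only [numSer] at hlt
  -- If the root is the only series join, neither side has inner vertices, leaving source, gluing
  -- point and terminal.
  have ha := (vertexSet_subset_iff a).2 (by omega)
  have hb := (vertexSet_subset_iff b).2 (by omega)
  have hglue := isGluing_series a.toSTGraph b.toSTGraph
  have hsub : V((a.toSTGraph.series b.toSTGraph).graph) ⊆
      {(seriesMap a.toSTGraph.tgt b.toSTGraph.src ∘ Sum.inl) a.toSTGraph.src,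
        (seriesMap a.toSTGraph.tgt b.toSTGraph.src ∘ Sum.inl) a.toSTGraph.tgt,
        (seriesMap a.toSTGraph.tgt b.toSTGraph.src ∘ Sum.inr) b.toSTGraph.tgt} := by
    rw [hglue.vertexSet_eq]
    rintro _ (⟨x, hx, rfl⟩ | ⟨x, hx, rfl⟩)
    · rcases ha hx with hx | hx
      exacts [.inl (congr_arg _ hx), .inr (.inl (congr_arg _ hx))]
    · rcases hb hx with hx | hx
      · exact .inr (.inl ((congr_arg _ hx).trans
          ((series_meet a.toSTGraph b.toSTGraph _ _).2 ⟨rfl, rfl⟩).symm))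
      · exact .inr (.inr (congr_arg _ hx))
  have h1 := h.trans (ncard_le_three_of_subset hsub)
  omega

end DecompTree

end SeriesParallel

end

theorem mainTheorem8
    (H₁ : SeriesParallel.STGraph.{u}) (L : List SeriesParallel.STGraph.{u})
    (hL : L ≠ [])
    (hH : ∀ K ∈ H₁ :: L, K.IsPath ∨ K.HasHamiltonianFace)
    (D : SeriesParallel.DecompTree)
    (hD : D.IsDecompositionOf (H₁.seriesList L))
    (hcard : 4 ≤ (H₁.seriesList L).graph.vertexSet.ncard) :
    ∀ e ∈ D.dual.toSTGraph.graph.edgeSet,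
      D.dual.toSTGraph.SimultaneousCombination e ∧
      SeriesParallel.ConditionOne D.dual.toSTGraph.graph e := by
  obtain ⟨φ⟩ := hD
  have htrace := SeriesParallel.STGraph.isTraceable_seriesList fun K hK =>
    (hH K hK).elim (·.isTraceable) (·.isTraceable)
  have hthin := SeriesParallel.DecompTree.isThin_of_isTraceable (φ.isTraceable htrace)
  obtain ⟨a, b, rfl⟩ := SeriesParallel.DecompTree.exists_eq_ser hthin
    (mt φ.adj_src_tgt_iff.1 (SeriesParallel.STGraph.not_adj_seriesList H₁ hL))
  rw [← φ.ncard_eq] at hcard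
  exact SeriesParallel.DecompTree.combination_and_conditionOne hthin.1 hthin.2
    (SeriesParallel.DecompTree.two_le_numSer hcard)
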